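/- **Setting.** There are $n\ge 1$ arms and a mediator with values in a finite set $\mathcal M$. Pulling arm $a$ draws $(M,O,Y)$ from a fixed law $\nu_a$. The mediator $M$ is always observed; the real reward $Y$ is observed exactly when $O=1$. Write $p_{m,a}=\mathbb P(M=m\mid A=a)$, $\gamma_{m,a}=\mathbb P(O=1\mid M=m,A=a)$, $\mu_{m,a}=\mathbb E[Y\mid M=m,A=a]$, $\mu_a=\mathbb E[Y\mid A=a]$, $P_a=\sum_m p_{m,a}/\gamma_{m,a}$, $S=\frac1n\sum_a P_a$. Assume $p_{m,a}>0$ and $\gamma_{m,a}>0$ (positivity), that $O$ and $Y$ are independent given $(A,M)$ (missing at random, MAR), that $\mu_{m,a}\in[0,1]$, and that $Y$ is sub-Gaussian: for some $c\ge 0$, $\mathbb E[e^{\lambda(Y-\mu_{m,a})}\mid M=m,A=a]\le e^{c\lambda^2/2}$ for all $\lambda\in\mathbb R$ and all $m,a$. The regret is $R_T=\sum_{t=1}^T(\max_a\mu_a-\mu_{a_t})$. **Algorithm** (unknown $p_{m,a}$, parameter $\alpha$, horizon $T$). First pull each arm in turn $\lceil(\log T)^2\rceil$ times. In every later round let, for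 the rounds so far, $T_a$ be the number of pulls of $a$, $s_{m,a}$ the number of those with $M=m$, $T_{m,a,o}$ the number of those with $M=m$ and $O=1$, $\hat\mu_{m,a}$ the average of the rewards observed in the latter, $\hat p_{m,a}=s_{m,a}/T_a$ and $\hat\mu_a=\frac1{T_a}\sum_{s:\,a_s=a}\hat\mu_{M_s,a}$, and pull an arm maximizing $$\mathrm{UCB}_a=\hat\mu_a+8\sqrt{\frac{\alpha\log T}{2}\sum_m\frac{\hat p_{m,a}^2}{T_{m,a,o}}}$$ (ties are broken arbitrarily, and the choice is arbitrary in a round in which some $T_{m,a,o}$ is $0$). **Theorem.** There is an absolute constant $C>0$ such that for all $n$, $\mathcal M$ and $\alpha>1$, the bound $$\mathbb E[R_T]\le C\sqrt{\alpha\, T\log(T)\, n S}$$ holds for all sufficiently large $T$, in the following two senses. 1. For all environments as above with variance proxy $c=1$, it holds for $T\ge T_0$, where $T_0$ depends only on $n$, $|\mathcal M|$, $\alpha$ and the numbers $p_{m,a},\gamma_{m,a}$ (not on the reward distributions or the gaps between the means $\mu_a$). 2. For every environment as above, with any variance proxy $c$, it holds for $T\ge T_0$, where $T_0$ may depend on the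 environment and $\alpha$. -/

import Mathlib

open MeasureTheory ProbabilityTheory Filter
open scoped NNReal

universe u

noncomputable section

namespace MissingBandit

/-- The tuple `(M, O, Y)` drawn when an arm is pulled: the mediator `M` (always observed, with
values in a finite set of size `K`), the indicator `O` that the reward is observed, and the true
reward `Y`, which the agent sees only when `O = true`. -/
abbrev Outcome (K : ℕ) : Type := Fin K × Bool × ℝ

/-- The mediator. -/
def med {K : ℕ} (z : Outcome K) : Fin K := z.1

/-- The indicator that the reward is observed. -/
def obs {K : ℕ} (z : Outcome K) : Bool := z.2.1

/-- The true (possibly unobserved) reward. -/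
def reward {K : ℕ} (z : Outcome K) : ℝ := z.2.2

section Environment

/-! An environment assigns to each of the `n` arms the joint law of `(M, O, Y)`. -/

variable {n K : ℕ} (ν : Fin n → Measure (Outcome K))

/-- The law of `(M, O, Y)` under arm `a`, conditioned on `M = m`. -/
def condLaw (m : Fin K) (a : Fin n) : Measure (Outcome K) :=
  ProbabilityTheory.cond (ν a) {z | med z = m}

/-- `p_{m,a}`, the probability of `M = m` under arm `a`. -/
def pMed (m : Fin K) (a : Fin n) : ℝ := (ν a).real {z | med z = m}

/-- `γ_{m,a}`, the probability of `O = 1` given `M = m` under arm `a`. -/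
def gam (m : Fin K) (a : Fin n) : ℝ := (condLaw ν m a).real {z | obs z = true}

/-- `E[Y | M = m, A = a]`. -/
def muMed (m : Fin K) (a : Fin n) : ℝ := ∫ z, reward z ∂(condLaw ν m a)

/-- `μ_a = E[Y | A = a]`. -/
def mu (a : Fin n) : ℝ := ∫ z, reward z ∂(ν a)

/-- `P_a = ∑_m p_{m,a} / γ_{m,a}`. -/
def Psum (a : Fin n) : ℝ := ∑ m, pMed ν m a / gam ν m a

/-- `S`, the arithmetic mean of the `P_a`. -/
def Smean : ℝ := (1 / (n : ℝ)) * ∑ a, Psum ν a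

/-- The standing assumptions on the environment: positivity, missingness at random
(`O` and `Y` independent given `M` and the arm), and conditional mean rewards in `[0, 1]`. -/
structure IsMAR : Prop where
  isProb : ∀ a, IsProbabilityMeasure (ν a)
  pMed_pos : ∀ m a, 0 < pMed ν m a
  gam_pos : ∀ m a, 0 < gam ν m a
  mar : ∀ m a, IndepFun (obs (K := K)) (reward (K := K)) (condLaw ν m a)
  mean_mem : ∀ m a, muMed ν m a ∈ Set.Icc (0 : ℝ) 1

/-- Given the mediator and the arm, the centred reward is sub-Gaussian with variance proxy `c`. -/
def IsSubgaussian (c : ℝ≥0) : Prop :=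
  ∀ m a, HasSubgaussianMGF (fun z => reward z - muMed ν m a) c (condLaw ν m a)

end Environment

section Algorithm

/-! Statistics of the first `t` rounds (rounds are numbered `0, 1, 2, …`), as functions of the
sequence `A` of arms pulled and the sequence `Z` of drawn tuples. Rewards enter only through the
rounds in which they are observed. -/

variable {n K : ℕ} (A : ℕ → Fin n) (Z : ℕ → Outcome K) (t : ℕ)

/-- The rounds before `t` in which arm `a` was pulled. -/
def armRounds (a : Fin n) : Finset ℕ := {s ∈ Finset.range t | A s = a}

/-- The rounds before `t` in which arm `a` was pulled and `M = m`. -/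
def medRounds (m : Fin K) (a : Fin n) : Finset ℕ := {s ∈ armRounds A t a | med (Z s) = m}

/-- The rounds before `t` in which arm `a` was pulled, `M = m`, and the reward was observed. -/
def obsRounds (m : Fin K) (a : Fin n) : Finset ℕ :=
  {s ∈ medRounds A Z t m a | obs (Z s) = true}

/-- `p̂_{m,a} = s_{m,a} / T_a`. -/
def pHat (m : Fin K) (a : Fin n) : ℝ :=
  ((medRounds A Z t m a).card : ℝ) / ((armRounds A t a).card : ℝ)

/-- `μ̂_{m,a}`, the average of the observed rewards of arm `a` with `M = m`. -/
def muHatMed (m : Fin K) (a : Fin n) : ℝ :=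
  (∑ s ∈ obsRounds A Z t m a, reward (Z s)) / ((obsRounds A Z t m a).card : ℝ)

/-- `μ̂_a`, the average of `μ̂_{M_s,a}` over the rounds `s` in which arm `a` was pulled. -/
def muHat (a : Fin n) : ℝ :=
  (1 / ((armRounds A t a).card : ℝ)) *
    ∑ s ∈ armRounds A t a, ∑ m, if med (Z s) = m then muHatMed A Z t m a else 0

/-- The upper confidence bound with inflated width
`μ̂_a + 8 √((α log T / 2) ∑_m p̂_{m,a}² / T_{m,a,o})`, for horizon `T`. -/
def ucb (α : ℝ) (T : ℕ) (a : Fin n) : ℝ :=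
  muHat A Z t a + 8 * Real.sqrt ((α * Real.log T / 2) *
    ∑ m, (pHat A Z t m a) ^ 2 / ((obsRounds A Z t m a).card : ℝ))

end Algorithm

/-- The number `(log T)²`, rounded up, of initial pulls of each arm. -/
def initPulls (T : ℕ) : ℕ := ⌈(Real.log T) ^ 2⌉₊

/-- `(A, Z)` is a run of `T` rounds of the algorithm in the environment `ν`, on the probability
space `(Ω, P)` with filtration `ℱ` (`ℱ t` contains the information before round `t`, and possibly
additional randomness, e.g. for breaking ties): the arm `A t` is chosen on the basis of `ℱ t`;
given `ℱ t`, the tuple `Z t` has the law of the arm pulled; first each arm in turn is pulled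
`initPulls T` times, and afterwards an arm of maximal upper confidence bound is pulled.
If some `T_{m,a,o}` is still zero, so that the confidence widths divide by zero, the choice of the
arm is left free, so that every convention for such rounds is covered. -/
structure IsRun {n K : ℕ} (ν : Fin n → Measure (Outcome K)) (α : ℝ) (T : ℕ)
    {Ω : Type*} [mΩ : MeasurableSpace Ω] (P : Measure Ω) (ℱ : Filtration ℕ mΩ)
    (A : ℕ → Ω → Fin n) (Z : ℕ → Ω → Outcome K) : Prop where
  arm_measurable : ∀ t < T, Measurable[ℱ t] (A t)
  outcome_measurable : ∀ t < T, Measurable[ℱ (t + 1)] (Z t)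
  outcome_law : ∀ t < T, ∀ B : Set (Outcome K), MeasurableSet B →
    P[(Z t ⁻¹' B).indicator (fun _ => (1 : ℝ)) | ℱ t] =ᵐ[P] fun ω => (ν (A t ω)).real B
  explore : ∀ t < T, t < n * initPulls T → ∀ ω, (A t ω : ℕ) = t / initPulls T
  greedy : ∀ t < T, n * initPulls T ≤ t → ∀ ω,
    (∀ m a, 0 < (obsRounds (fun s => A s ω) (fun s => Z s ω) t m a).card) →
    ∀ b, ucb (fun s => A s ω) (fun s => Z s ω) t α T b
      ≤ ucb (fun s => A s ω) (fun s => Z s ω) t α T (A t ω)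

/-- The cumulative regret `∑_{t < T} (μ_{a*} - μ_{A t})`, where `μ_{a*}` is the largest mean. -/
def regret {n K : ℕ} (ν : Fin n → Measure (Outcome K)) (T : ℕ) (A : ℕ → Fin n) : ℝ :=
  ∑ t ∈ Finset.range T, ((⨆ a, mu ν a) - mu ν (A t))

/-- Every run of `T` rounds of the algorithm with parameter `α` in the environment `ν` has
expected regret at most `C √(α T log T · n S)`. -/
def RegretBound {n K : ℕ} (ν : Fin n → Measure (Outcome K)) (α C : ℝ) (T : ℕ) : Prop :=
  ∀ (Ω : Type u) (mΩ : MeasurableSpace Ω) (P : Measure Ω), IsProbabilityMeasure P →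
    ∀ (ℱ : Filtration ℕ mΩ) (A : ℕ → Ω → Fin n) (Z : ℕ → Ω → Outcome K),
      IsRun ν α T P ℱ A Z →
        ∫ ω, regret ν T (fun t => A t ω) ∂P
          ≤ C * Real.sqrt (α * T * Real.log T * (n * Smean ν))

end MissingBandit

end

/-!
The algorithm is optimistic, and its regret is bounded by adding up the confidence widths of the
arms pulled. Three points need an argument.

*Adaptive sampling.* The rounds in which an arm is pulled depend on the past. Nevertheless, for
nonnegative functions `f i` of the outcomes, the expectation of the product of `f i` over the first
`s` pulls of an arm, on the event that there are exactly `s` of them, is at most the product of the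
integrals of the `f i` (`IsRun.lintegral_prod_le`): replacing the factors of the pulls still to come
by their integrals gives a supermartingale. So Chernoff bounds for independent samples apply, with a
union over the possible numbers of pulls.

*The confidence width.* The error of `μ̂_a` splits into `∑_m p̂_{m,a} (μ̂_{m,a} - μ_{m,a})` and the
error of the average of `μ_{M,a}` (`muHat_sub_mu`). In the first part the weights of the rewards
depend on all mediators and observation indicators of the arm, not on the rewards. As the rewards
are missing at random, once these values are fixed the first part is sub-Gaussian with proxy
`c V`, where `V = ∑_m p̂_{m,a}² / T_{m,a,o}`; the bound is proved for every possible sequence of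
values and then summed (`IsRun.measure_rewardError_gt_le`), which avoids a factor depending on the
number of mediators. The second part is handled by Hoeffding's inequality, because `V ≥ 1 / T_a`.

*Adding up.* After `(log T)²` pulls the empirical frequencies are within a factor of two of the
probabilities, so `V ≤ 8 P_a / T_a` (`Concentrated.widthSq_le`). For variance proxy `1` the
confidence bounds hold with high probability, the gap of the arm pulled is at most
`32 √(α log T · P_a / T_a)`, and these terms sum to `O(√(α T log T · n S))` by the inequality of
Cauchy and Schwarz (`sum_loss_le`). For any other proxy the confidence bounds may fail, but the
initial pulls alone bring all estimates and widths within `O(1 / √(log T))` of their limits. For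
`T` large this is less than every positive gap, so that only optimal arms are pulled after the
initial rounds, whose cost is of lower order (`regretBound_of_gaps`).
-/

namespace MissingBandit

open scoped ENNReal

/-! ### Counting pulls -/

section Pulls

variable {n : ℕ} {A : ℕ → Fin n} {t : ℕ} {a : Fin n}

/-- The number of pulls of arm `a` before round `t`. For a round `r` in which `a` is pulled,
`pulls A r a` is also the index of that pull among the pulls of `a`, counted from `0`. -/
abbrev pulls (A : ℕ → Fin n) (t : ℕ) (a : Fin n) : ℕ := (armRounds A t a).card

lemma mem_armRounds {r : ℕ} : r ∈ armRounds A t a ↔ r < t ∧ A r = a := by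
  simp [armRounds]

lemma armRounds_succ_of_eq (h : A t = a) :
    armRounds A (t + 1) a = insert t (armRounds A t a) := by
  ext r
  simp only [Finset.mem_insert, mem_armRounds]
  constructor
  · rintro ⟨h1, h2⟩
    by_cases hr : r = t
    · exact Or.inl hr
    · exact Or.inr ⟨by omega, h2⟩
  · rintro (rfl | ⟨h1, h2⟩)
    · exact ⟨by omega, h⟩
    · exact ⟨by omega, h2⟩

lemma armRounds_succ_of_ne (h : A t ≠ a) : armRounds A (t + 1) a = armRounds A t a := by
  ext r
  simp only [mem_armRounds]
  constructor
  · rintro ⟨h1, h2⟩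
    refine ⟨lt_of_le_of_ne (by omega) ?_, h2⟩
    rintro rfl
    exact h h2
  · rintro ⟨h1, h2⟩
    exact ⟨by omega, h2⟩

lemma notMem_armRounds : t ∉ armRounds A t a := by simp [mem_armRounds]

lemma pulls_succ_of_eq (h : A t = a) : pulls A (t + 1) a = pulls A t a + 1 := by
  rw [pulls, armRounds_succ_of_eq h, Finset.card_insert_of_notMem notMem_armRounds]

lemma pulls_succ_of_ne (h : A t ≠ a) : pulls A (t + 1) a = pulls A t a := by
  rw [pulls, armRounds_succ_of_ne h]

lemma pulls_le : pulls A t a ≤ t := by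
  refine (Finset.card_filter_le (Finset.range t) (fun s => A s = a)).trans ?_
  simp

lemma sum_pulls (A : ℕ → Fin n) (t : ℕ) : ∑ a, pulls A t a = t := by
  have := Finset.card_eq_sum_card_fiberwise (f := A) (s := Finset.range t)
    (t := Finset.univ) (fun _ _ => by simp)
  simpa [pulls, armRounds] using this.symm

lemma armRounds_mono {r : ℕ} (h : r ≤ t) : armRounds A r a ⊆ armRounds A t a := by
  intro i hi
  rw [mem_armRounds] at hi ⊢
  exact ⟨by omega, hi.2⟩

lemma pulls_mono {r : ℕ} (h : r ≤ t) : pulls A r a ≤ pulls A t a :=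
  Finset.card_le_card (armRounds_mono h)

lemma pulls_lt_of_mem {r : ℕ} (h : r ∈ armRounds A t a) : pulls A r a < pulls A t a := by
  rw [mem_armRounds] at h
  have := pulls_mono (A := A) (a := a) (show r + 1 ≤ t from h.1)
  rw [pulls_succ_of_eq h.2] at this
  omega

lemma pulls_injOn : Set.InjOn (fun r => pulls A r a) (armRounds A t a) := by
  intro r hr r' hr' h
  simp only [Finset.mem_coe, mem_armRounds] at hr hr'
  simp only at h
  rcases lt_trichotomy r r' with hlt | rfl | hlt
  · have := pulls_lt_of_mem (A := A) (t := r') (a := a) (mem_armRounds.2 ⟨hlt, hr.2⟩)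
    omega
  · rfl
  · have := pulls_lt_of_mem (A := A) (t := r) (a := a) (mem_armRounds.2 ⟨hlt, hr'.2⟩)
    omega

/-- The pulls of an arm carry the indices `0, 1, …` in order. -/
lemma sum_armRounds_index {β : Type*} [AddCommMonoid β] (g : ℕ → β) :
    ∑ r ∈ armRounds A t a, g (pulls A r a) = ∑ i ∈ Finset.range (pulls A t a), g i := by
  induction t with
  | zero => simp [armRounds, pulls]
  | succ t ih =>
    by_cases h : A t = a
    · rw [pulls_succ_of_eq h, armRounds_succ_of_eq h, Finset.sum_insert notMem_armRounds,
        Finset.sum_range_succ, ih, add_comm]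
    · rw [pulls_succ_of_ne h, armRounds_succ_of_ne h, ih]

end Pulls

/-! ### Sampling from one arm -/

section Sampling

variable {n K : ℕ} {ν : Fin n → Measure (Outcome K)} {α : ℝ} {T : ℕ}
  {Ω : Type*} [mΩ : MeasurableSpace Ω] {P : Measure Ω} {ℱ : Filtration ℕ mΩ}
  {A : ℕ → Ω → Fin n} {Z : ℕ → Ω → Outcome K}

lemma IsRun.measurableSet_arm (h : IsRun ν α T P ℱ A Z) {t : ℕ} (ht : t < T) (a : Fin n) :
    MeasurableSet[ℱ t] {ω | A t ω = a} :=
  h.arm_measurable t ht (measurableSet_singleton a)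

lemma IsRun.measurable_outcome (h : IsRun ν α T P ℱ A Z) {r : ℕ} (hr : r < T) :
    Measurable (Z r) := (h.outcome_measurable r hr).mono (ℱ.le _) le_rfl

lemma IsRun.measure_inter [IsProbabilityMeasure P] [∀ a, IsProbabilityMeasure (ν a)]
    (h : IsRun ν α T P ℱ A Z) {t : ℕ} (ht : t < T) (a : Fin n) {E : Set Ω}
    (hE : MeasurableSet[ℱ t] E) (hEa : E ⊆ {ω | A t ω = a}) {B : Set (Outcome K)}
    (hB : MeasurableSet B) : P (E ∩ Z t ⁻¹' B) = P E * ν a B := by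
  have hZB : MeasurableSet (Z t ⁻¹' B) := h.measurable_outcome ht hB
  have hE' : MeasurableSet E := ℱ.le t _ hE
  have h1 := setIntegral_condExp (μ := P) (ℱ.le t)
    (f := (Z t ⁻¹' B).indicator (fun _ => (1 : ℝ))) ((integrable_const 1).indicator hZB) hE
  have h2 : ∫ ω in E, P[(Z t ⁻¹' B).indicator (fun _ => (1 : ℝ)) | ℱ t] ω ∂P
      = ∫ ω in E, (ν a).real B ∂P := by
    refine setIntegral_congr_ae hE' ?_
    filter_upwards [h.outcome_law t ht B hB] with ω hω hωE
    have := hEa hωE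
    simp only [Set.mem_ofPred_eq] at this
    rw [hω, this]
  rw [h2, setIntegral_const, setIntegral_indicator hZB, setIntegral_const] at h1
  simp only [smul_eq_mul, mul_one, measureReal_def, ← ENNReal.toReal_mul] at h1
  exact ((ENNReal.toReal_eq_toReal_iff' (by finiteness) (by finiteness)).1 h1).symm

/-- Given the past `ℱ t`, on the event that arm `a` is pulled, the outcome of round `t` is
distributed according to `ν a`. -/
lemma IsRun.lintegral_step [IsProbabilityMeasure P] [∀ a, IsProbabilityMeasure (ν a)]
    (h : IsRun ν α T P ℱ A Z) {t : ℕ} (ht : t < T) (a : Fin n) {g : Outcome K → ℝ≥0∞}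
    (hg : Measurable g) {φ : Ω → ℝ≥0∞} (hφ : Measurable[ℱ t] φ) :
    ∫⁻ ω in {ω | A t ω = a}, φ ω * g (Z t ω) ∂P
      = (∫⁻ ω in {ω | A t ω = a}, φ ω ∂P) * ∫⁻ z, g z ∂ν a := by
  have hA := h.measurableSet_arm ht a
  have hA' : MeasurableSet {ω | A t ω = a} := ℱ.le t _ hA
  have hgZ : Measurable fun ω => g (Z t ω) := hg.comp (h.measurable_outcome ht)
  refine @Measurable.ennreal_induction Ω (ℱ t) (fun φ =>
    ∫⁻ ω in {ω | A t ω = a}, φ ω * g (Z t ω) ∂P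
      = (∫⁻ ω in {ω | A t ω = a}, φ ω ∂P) * ∫⁻ z, g z ∂ν a) ?_ ?_ ?_ φ hφ
  · intro c E hE
    have hE' : MeasurableSet E := ℱ.le t _ hE
    have hmap : (P.restrict (E ∩ {ω | A t ω = a})).map (Z t)
        = P (E ∩ {ω | A t ω = a}) • ν a := by
      ext B hB
      have hZ := h.measurable_outcome ht
      rw [Measure.map_apply hZ hB, Measure.restrict_apply (hZ hB), Set.inter_comm,
        h.measure_inter ht a (hE.inter hA) Set.inter_subset_right hB]
      simp
    have h1 : ∀ ω, E.indicator (fun _ => c) ω * g (Z t ω)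
        = E.indicator (fun ω => c * g (Z t ω)) ω := by
      intro ω
      by_cases hω : ω ∈ E <;> simp [hω]
    simp_rw [h1]
    rw [lintegral_indicator hE', Measure.restrict_restrict hE', lintegral_const_mul _ hgZ,
      ← lintegral_map hg (h.measurable_outcome ht), hmap, lintegral_smul_measure,
      lintegral_indicator hE', Measure.restrict_restrict hE', lintegral_const]
    simp [mul_assoc]
  · intro f g' _ hf hg' h1 h2
    simp only [Pi.add_apply, add_mul]
    have hf' : Measurable f := hf.mono (ℱ.le t) le_rfl
    rw [lintegral_add_left (f := fun ω => f ω * g (Z t ω)) (hf'.mul hgZ),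
      lintegral_add_left hf', h1, h2, add_mul]
  · intro f hf hmono h1
    have hf' : ∀ i, Measurable (f i) := fun i => (hf i).mono (ℱ.le t) le_rfl
    simp only [ENNReal.iSup_mul]
    rw [lintegral_iSup (f := fun i ω => f i ω * g (Z t ω)) (fun i => (hf' i).mul hgZ),
      lintegral_iSup hf' hmono, ENNReal.iSup_mul]
    · exact iSup_congr h1
    · intro i j hij ω
      exact mul_le_mul_left (hmono hij ω) _

lemma IsRun.measurable_pulls (h : IsRun ν α T P ℱ A Z) {t : ℕ} (ht : t ≤ T) (a : Fin n) :
    Measurable[ℱ t] fun ω => pulls (fun s => A s ω) t a := by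
  simp only [pulls, armRounds, Finset.card_filter]
  refine Finset.measurable_fun_sum _ fun r hr => ?_
  have hr' := Finset.mem_range.1 hr
  exact Measurable.ite (ℱ.mono hr'.le _ (h.measurableSet_arm (by omega) a)) measurable_const
    measurable_const

lemma IsRun.measurable_prod (h : IsRun ν α T P ℱ A Z) {t : ℕ} (ht : t ≤ T) (a : Fin n)
    {f : ℕ → Outcome K → ℝ≥0∞} (hf : ∀ i, Measurable (f i)) :
    Measurable[ℱ t] fun ω => ∏ r ∈ armRounds (fun s => A s ω) t a,
      f (pulls (fun s => A s ω) r a) (Z r ω) := by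
  simp only [armRounds, Finset.prod_filter]
  refine Finset.measurable_fun_prod _ fun r hr => ?_
  have hr' := Finset.mem_range.1 hr
  refine Measurable.ite (ℱ.mono hr'.le _ (h.measurableSet_arm (by omega) a)) ?_ measurable_const
  have hu : Measurable (Function.uncurry f) := measurable_from_prod_countable_right hf
  exact hu.comp (((h.measurable_pulls (by omega) a).mono (ℱ.mono hr'.le) le_rfl).prodMk
    ((h.outcome_measurable r (by omega)).mono (ℱ.mono hr') le_rfl))

/-- The outcomes of the first `s` pulls of an arm behave, for upper bounds, like an independent
sample from its law, although the times of the pulls depend on the outcomes. -/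
lemma IsRun.lintegral_prod_le [IsProbabilityMeasure P] [∀ a, IsProbabilityMeasure (ν a)]
    (h : IsRun ν α T P ℱ A Z) {t : ℕ} (ht : t ≤ T) (a : Fin n)
    {f : ℕ → Outcome K → ℝ≥0∞} (hf : ∀ i, Measurable (f i)) (s : ℕ) :
    ∫⁻ ω in {ω | pulls (fun s => A s ω) t a = s}, ∏ r ∈ armRounds (fun s => A s ω) t a,
      f (pulls (fun s => A s ω) r a) (Z r ω) ∂P ≤ ∏ i ∈ Finset.range s, ∫⁻ z, f i z ∂ν a := by
  set c : ℕ → ℝ≥0∞ := fun i => ∫⁻ z, f i z ∂ν a with hc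
  set k : ℕ → Ω → ℕ := fun t ω => pulls (fun s => A s ω) t a with hk
  set Ψ : ℕ → Ω → ℝ≥0∞ := fun t ω => ∏ r ∈ armRounds (fun s => A s ω) t a,
      f (k r ω) (Z r ω) with hΨ
  -- The samples still missing are replaced by their expectations.
  set Φ : ℕ → Ω → ℝ≥0∞ := fun t ω =>
    (if k t ω ≤ s then 1 else 0) * Ψ t ω * ∏ i ∈ Finset.Ico (k t ω) s, c i with hΦ
  have hkm : ∀ t ≤ T, Measurable[ℱ t] (k t) := fun t ht => h.measurable_pulls ht a
  have hΨm : ∀ t ≤ T, Measurable[ℱ t] (Ψ t) := fun t ht => h.measurable_prod ht a hf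
  have key : ∀ t ≤ T, ∫⁻ ω, Φ t ω ∂P ≤ ∏ i ∈ Finset.range s, c i := by
    intro t
    induction t with
    | zero =>
      intro _
      simp [hΦ, hk, hΨ, pulls, armRounds]
    | succ t ih =>
      intro ht
      refine le_trans ?_ (ih (by omega))
      have hA : MeasurableSet {ω | A t ω = a} := ℱ.le t _ (h.measurableSet_arm (by omega) a)
      rw [← lintegral_add_compl (Φ (t + 1)) hA, ← lintegral_add_compl (Φ t) hA]
      refine add_le_add ?_ (le_of_eq ?_)
      · set φ : ℕ → Ω → ℝ≥0∞ := fun i ω => (if k t ω = i then 1 else 0) *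
          ((if i + 1 ≤ s then 1 else 0) * Ψ t ω * ∏ j ∈ Finset.Ico (i + 1) s, c j) with hφ
        have hφm : ∀ i, Measurable[ℱ t] (φ i) := fun i =>
          (Measurable.ite (hkm t (by omega) (measurableSet_singleton i)) measurable_const
            measurable_const).mul (((hΨm t (by omega)).const_mul _).mul_const _)
        have hφm' : ∀ i, Measurable (φ i) := fun i => (hφm i).mono (ℱ.le t) le_rfl
        have h1 : ∫⁻ ω in {ω | A t ω = a}, Φ (t + 1) ω ∂P
            = ∫⁻ ω in {ω | A t ω = a}, ∑ i ∈ Finset.range (t + 1), φ i ω * f i (Z t ω) ∂P := by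
          refine setLIntegral_congr_fun hA fun ω hω => ?_
          have hω' : (fun s => A s ω) t = a := hω
          have hkt : k t ω < t + 1 := Nat.lt_succ_of_le pulls_le
          have hk1 : k (t + 1) ω = k t ω + 1 := pulls_succ_of_eq hω'
          have hΨ1 : Ψ (t + 1) ω = f (k t ω) (Z t ω) * Ψ t ω := by
            simp only [hΨ]
            rw [armRounds_succ_of_eq hω', Finset.prod_insert notMem_armRounds]
          rw [Finset.sum_eq_single (k t ω)]
          · simp only [hΦ, hφ, hk1, hΨ1, if_true]
            ring
          · intro i _ hi
            simp [hφ, hi.symm]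
          · intro hi
            exact absurd (Finset.mem_range.2 hkt) hi
        rw [h1, lintegral_finsetSum (f := fun i ω => φ i ω * f i (Z t ω)) _ fun i _ =>
          (hφm' i).mul ((hf i).comp (h.measurable_outcome (r := t) (by omega)))]
        simp_rw [fun i => h.lintegral_step (t := t) (by omega) a (hf i) (hφm i),
          fun i => (lintegral_mul_const (μ := P.restrict {ω | A t ω = a})
            (∫⁻ z, f i z ∂ν a) (hφm' i)).symm]
        rw [← lintegral_finsetSum _ fun i _ => (hφm' i).mul_const _]
        refine lintegral_mono fun ω => ?_
        have hkt : k t ω < t + 1 := Nat.lt_succ_of_le pulls_le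
        rw [Finset.sum_eq_single (k t ω)]
        · simp only [hφ, hΦ, if_true, one_mul]
          by_cases hs : k t ω + 1 ≤ s
          · rw [if_pos hs, if_pos (show k t ω ≤ s by omega),
              Finset.prod_eq_prod_Ico_succ_bot (show k t ω < s by omega) c]
            simp only [one_mul]
            rw [mul_assoc, mul_comm (∏ j ∈ Finset.Ico (k t ω + 1) s, c j)]
          · rw [if_neg hs]
            simp
        · intro i _ hi
          simp [hφ, hi.symm]
        · intro hi
          exact absurd (Finset.mem_range.2 hkt) hi
      · refine setLIntegral_congr_fun hA.compl fun ω hω => ?_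
        have hω' : (fun s => A s ω) t ≠ a := hω
        have hk1 : k (t + 1) ω = k t ω := pulls_succ_of_ne hω'
        simp only [hΦ, hΨ, hk1]
        rw [armRounds_succ_of_ne hω']
  refine le_trans ?_ (key t ht)
  have hset : MeasurableSet {ω | k t ω = s} :=
    ℱ.le t _ (hkm t ht (measurableSet_singleton s))
  rw [← lintegral_indicator hset]
  refine lintegral_mono fun ω => ?_
  by_cases hω : k t ω = s
  · rw [Set.indicator_of_mem (by exact hω)]
    simp only [hΦ, hω, le_refl, if_true, Finset.Ico_self, Finset.prod_empty, one_mul, mul_one]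
    exact le_rfl
  · rw [Set.indicator_of_notMem (by exact hω)]
    exact zero_le

end Sampling

/-! ### Laws of the mediator, the observation indicator and the reward -/

section Laws

variable {n K : ℕ} {ν : Fin n → Measure (Outcome K)}

@[fun_prop]
lemma measurable_med : Measurable (med (K := K)) := measurable_fst

@[fun_prop]
lemma measurable_obs : Measurable (obs (K := K)) := measurable_snd.fst

@[fun_prop]
lemma measurable_reward : Measurable (reward (K := K)) := measurable_snd.snd

lemma measurableSet_med (m : Fin K) : MeasurableSet {z : Outcome K | med z = m} :=
  measurable_med (measurableSet_singleton m)

lemma measurableSet_obs (o : Bool) : MeasurableSet {z : Outcome K | obs z = o} :=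
  measurable_obs (measurableSet_singleton o)

lemma IsMAR.measure_med_ne_zero (hν : IsMAR ν) (m : Fin K) (a : Fin n) :
    ν a {z | med z = m} ≠ 0 := by
  intro h
  have := hν.pMed_pos m a
  simp [pMed, measureReal_def, h] at this

lemma IsMAR.isProbabilityMeasure_condLaw (hν : IsMAR ν) (m : Fin K) (a : Fin n) :
    IsProbabilityMeasure (condLaw ν m a) :=
  have := hν.isProb a
  cond_isProbabilityMeasure (hν.measure_med_ne_zero m a)

lemma IsMAR.restrict_eq_smul_condLaw (hν : IsMAR ν) (m : Fin K) (a : Fin n) :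
    (ν a).restrict {z | med z = m} = ν a {z | med z = m} • condLaw ν m a := by
  have := hν.isProb a
  rw [condLaw, ProbabilityTheory.cond, smul_smul,
    ENNReal.mul_inv_cancel (hν.measure_med_ne_zero m a) (by finiteness), one_smul]

lemma IsMAR.measure_med_obs (hν : IsMAR ν) (m : Fin K) (a : Fin n) (o : Bool) :
    ν a {z | (med z, obs z) = (m, o)}
      = ν a {z | med z = m} * condLaw ν m a {z | obs z = o} := by
  have h1 := congrArg (fun μ => μ {z : Outcome K | obs z = o}) (hν.restrict_eq_smul_condLaw m a)
  simp only [Measure.restrict_apply (measurableSet_obs o), Measure.smul_apply, smul_eq_mul] at h1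
  rw [← h1]
  congr 1
  ext z
  simp [and_comm]

/-- Missingness at random: whether the reward is observed does not affect its law, once the
mediator is given. -/
lemma IsMAR.lintegral_med_obs (hν : IsMAR ν) (m : Fin K) (a : Fin n) (o : Bool)
    {G : ℝ → ℝ≥0∞} (hG : Measurable G) :
    ∫⁻ z, {z | (med z, obs z) = (m, o)}.indicator (fun z => G (reward z)) z ∂ν a
      = ν a {z | (med z, obs z) = (m, o)} * ∫⁻ z, G (reward z) ∂condLaw ν m a := by
  have hI : Measurable fun b : Bool => if b = o then (1 : ℝ≥0∞) else 0 :=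
    Measurable.of_discrete
  have h1 : ∀ z : Outcome K,
      {z | (med z, obs z) = (m, o)}.indicator (fun z => G (reward z)) z
        = {z | med z = m}.indicator
          (fun z => (if obs z = o then (1 : ℝ≥0∞) else 0) * G (reward z)) z := by
    intro z
    by_cases hm : med z = m <;> by_cases ho : obs z = o <;> simp [hm, ho]
  have h2 := lintegral_mul_eq_lintegral_mul_lintegral_of_indepFun
    (μ := condLaw ν m a) (hI.comp measurable_obs) (hG.comp measurable_reward)
    ((hν.mar m a).comp hI hG)
  have h3 : ∫⁻ z, ((fun b : Bool => if b = o then (1 : ℝ≥0∞) else 0) ∘ obs) z ∂condLaw ν m a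
      = condLaw ν m a {z | obs z = o} := by
    rw [← lintegral_indicator_one (measurableSet_obs o)]
    refine lintegral_congr fun z => ?_
    by_cases ho : obs z = o <;> simp [ho]
  simp_rw [h1]
  rw [lintegral_indicator (measurableSet_med m), hν.restrict_eq_smul_condLaw,
    lintegral_smul_measure, hν.measure_med_obs, mul_assoc, ← h3]
  exact congrArg _ h2

lemma sum_measure_med_obs (a : Fin n) [IsProbabilityMeasure (ν a)] :
    ∑ mo : Fin K × Bool, ν a {z | (med z, obs z) = mo} = 1 := by
  have hm : Measurable fun z : Outcome K => (med z, obs z) := by fun_prop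
  have := sum_measure_preimage_singleton (μ := ν a) (f := fun z : Outcome K => (med z, obs z))
    Finset.univ (fun y _ => hm (measurableSet_singleton y))
  simpa [Set.preimage] using this

end Laws

/-! ### Deviation bounds along the pulls of an arm -/

section Deviation

variable {n K : ℕ} {ν : Fin n → Measure (Outcome K)} {α : ℝ} {T : ℕ}
  {Ω : Type*} [mΩ : MeasurableSpace Ω] {P : Measure Ω} {ℱ : Filtration ℕ mΩ}
  {A : ℕ → Ω → Fin n} {Z : ℕ → Ω → Outcome K}

lemma IsRun.mul_measure_le [IsProbabilityMeasure P] [∀ a, IsProbabilityMeasure (ν a)]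
    (h : IsRun ν α T P ℱ A Z) {t : ℕ} (ht : t ≤ T) (a : Fin n)
    {f : ℕ → Outcome K → ℝ≥0∞} (hf : ∀ i, Measurable (f i)) (s : ℕ) (ε : ℝ≥0∞) :
    ε * P {ω | pulls (fun s => A s ω) t a = s ∧ ε ≤ ∏ r ∈ armRounds (fun s => A s ω) t a,
      f (pulls (fun s => A s ω) r a) (Z r ω)} ≤ ∏ i ∈ Finset.range s, ∫⁻ z, f i z ∂ν a := by
  refine le_trans ?_ (h.lintegral_prod_le ht a hf s)
  refine le_trans (le_of_eq ?_) (mul_meas_ge_le_lintegral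
    ((h.measurable_prod ht a hf).mono (ℱ.le t) le_rfl) ε)
  have hs : MeasurableSet {ω | pulls (fun s => A s ω) t a = s} :=
    ℱ.le t _ (h.measurable_pulls ht a (measurableSet_singleton s))
  rw [Measure.restrict_apply' hs]
  congr 2
  ext ω
  exact and_comm

/-- Splitting according to the number of pulls of an arm. -/
lemma measure_le_of_pulls {t : ℕ} (a : Fin n) {E : Set Ω} {b : ℝ≥0∞}
    (hE : ∀ s, P {ω | pulls (fun s => A s ω) t a = s ∧ ω ∈ E} ≤ b) :
    P E ≤ (t + 1) * b := by
  calc P E ≤ P (⋃ s ∈ Finset.range (t + 1), {ω | pulls (fun s => A s ω) t a = s ∧ ω ∈ E}) := by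
        refine measure_mono fun ω hω => ?_
        simp only [Set.mem_iUnion]
        exact ⟨_, Finset.mem_range.2 (Nat.lt_succ_of_le pulls_le), rfl, hω⟩
    _ ≤ ∑ s ∈ Finset.range (t + 1), P {ω | pulls (fun s => A s ω) t a = s ∧ ω ∈ E} :=
        measure_biUnion_finset_le _ _
    _ ≤ ∑ s ∈ Finset.range (t + 1), b := Finset.sum_le_sum fun s _ => hE s
    _ = (t + 1) * b := by simp

lemma ofReal_exp_cancel {x y : ℝ} {q b : ℝ≥0∞}
    (h : ENNReal.ofReal (Real.exp y) * q ≤ b * ENNReal.ofReal (Real.exp x)) :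
    q ≤ b * ENNReal.ofReal (Real.exp (x - y)) := by
  have hq : q = ENNReal.ofReal (Real.exp (-y)) * (ENNReal.ofReal (Real.exp y) * q) := by
    rw [← mul_assoc, ← ENNReal.ofReal_mul (Real.exp_nonneg _), ← Real.exp_add]
    simp
  rw [hq]
  refine (mul_le_mul_right h _).trans (le_of_eq ?_)
  rw [sub_eq_add_neg, Real.exp_add, ENNReal.ofReal_mul (Real.exp_nonneg _)]
  ring

/-- Chernoff's bound for the sum over the pulls of an arm. -/
lemma IsRun.measure_sum_gt_le [IsProbabilityMeasure P] [∀ a, IsProbabilityMeasure (ν a)]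
    (h : IsRun ν α T P ℱ A Z) {t : ℕ} (ht : t ≤ T) (a : Fin n) {X : Outcome K → ℝ}
    (hX : Measurable X) {c : ℝ≥0} (hc : 0 < c) (hXc : HasSubgaussianMGF X c (ν a))
    {x : ℝ} (hx : 0 ≤ x) :
    P {ω | √(2 * c * pulls (fun s => A s ω) t a * x)
        < ∑ r ∈ armRounds (fun s => A s ω) t a, X (Z r ω)}
      ≤ (t + 1) * ENNReal.ofReal (Real.exp (-x)) := by
  have hc' : (0 : ℝ) < c := hc
  refine measure_le_of_pulls (A := A) a fun s => ?_
  rcases Nat.eq_zero_or_pos s with rfl | hs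
  · refine le_trans (le_of_eq ?_) zero_le
    convert measure_empty (μ := P)
    ext ω
    simp only [Set.mem_ofPred_eq, Set.mem_empty_iff_false, iff_false, not_and]
    intro h0
    rw [h0, Finset.card_eq_zero.1 h0]
    simp
  have hs' : (0 : ℝ) < s := by exact_mod_cast hs
  -- The Chernoff parameter that minimises the bound.
  set l : ℝ := √(2 * x / (c * s)) with hl
  have hl2 : l ^ 2 = 2 * x / (c * s) := Real.sq_sqrt (by positivity)
  have hlx : l * √(2 * c * s * x) = 2 * x := by
    rw [hl, ← Real.sqrt_mul (by positivity)]
    rw [show 2 * x / (c * s) * (2 * c * s * x) = (2 * x) ^ 2 by field_simp]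
    exact Real.sqrt_sq (by positivity)
  have h1 := h.mul_measure_le ht a (f := fun _ z => ENNReal.ofReal (Real.exp (l * X z)))
    (fun _ => by fun_prop) s (ENNReal.ofReal (Real.exp (2 * x)))
  have h2 : ∏ i ∈ Finset.range s, ∫⁻ z, ENNReal.ofReal (Real.exp (l * X z)) ∂ν a
      ≤ 1 * ENNReal.ofReal (Real.exp x) := by
    rw [Finset.prod_const, Finset.card_range, one_mul,
      ← ofReal_integral_eq_lintegral_ofReal (hXc.integrable_exp_mul l)
        (Eventually.of_forall fun z => Real.exp_nonneg _),
      ← ENNReal.ofReal_pow (integral_nonneg fun z => Real.exp_nonneg _)]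
    refine ENNReal.ofReal_le_ofReal ?_
    calc (∫ z, Real.exp (l * X z) ∂ν a) ^ s ≤ (Real.exp (c * l ^ 2 / 2)) ^ s :=
          pow_le_pow_left₀ (integral_nonneg fun z => Real.exp_nonneg _) (hXc.mgf_le l) s
      _ = Real.exp x := by
          rw [← Real.exp_nat_mul, hl2]
          congr 1
          field_simp
  have h3 := ofReal_exp_cancel ((h1).trans h2)
  rw [one_mul, show x - 2 * x = -x by ring] at h3
  refine le_trans (measure_mono ?_) h3
  rintro ω ⟨hω1, hω2⟩
  refine ⟨hω1, ?_⟩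
  rw [← ENNReal.ofReal_prod_of_nonneg fun _ _ => Real.exp_nonneg _, ← Real.exp_sum,
    ← Finset.mul_sum]
  refine ENNReal.ofReal_le_ofReal (Real.exp_le_exp.2 ?_)
  rw [← hlx]
  simp only [Set.mem_ofPred_eq, hω1] at hω2
  exact mul_le_mul_of_nonneg_left hω2.le (Real.sqrt_nonneg _)

/-- Hoeffding's inequality for a `[0, 1]`-valued function of the outcomes of an arm. -/
lemma IsRun.measure_abs_sum_gt_le [IsProbabilityMeasure P] [∀ a, IsProbabilityMeasure (ν a)]
    (h : IsRun ν α T P ℱ A Z) {t : ℕ} (ht : t ≤ T) (a : Fin n) {f : Outcome K → ℝ}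
    (hf : Measurable f) (hf01 : ∀ z, f z ∈ Set.Icc (0 : ℝ) 1) {x : ℝ} (hx : 0 ≤ x) :
    P {ω | √(pulls (fun s => A s ω) t a * x / 2)
        < |∑ r ∈ armRounds (fun s => A s ω) t a, (f (Z r ω) - ∫ z, f z ∂ν a)|}
      ≤ (t + 1) * (2 * ENNReal.ofReal (Real.exp (-x))) := by
  have h0 := hasSubgaussianMGF_of_mem_Icc (μ := ν a) hf.aemeasurable
    (Eventually.of_forall hf01)
  have hc : ((‖(1 : ℝ) - 0‖₊ / 2) ^ 2 : ℝ≥0) = 1 / 4 := by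
    ext
    norm_num
  rw [hc] at h0
  have h1 := h.measure_sum_gt_le ht a (by fun_prop) (by norm_num) h0 hx
  have h2 := h.measure_sum_gt_le ht a (by fun_prop) (by norm_num) h0.neg hx
  calc _ ≤ _ := measure_mono (?_ : _ ⊆ {ω | _} ∪ {ω | _})
    _ ≤ _ := (measure_union_le _ _).trans (add_le_add h1 h2)
    _ = _ := by ring
  intro ω hω
  simp only [Set.mem_ofPred_eq, lt_abs] at hω
  have h4 : 2 * ((1 / 4 : ℝ≥0) : ℝ) * pulls (fun s => A s ω) t a * x
      = pulls (fun s => A s ω) t a * x / 2 := by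
    push_cast
    ring
  simp only [Set.mem_union, Set.mem_ofPred_eq, h4, Pi.neg_apply, Finset.sum_neg_distrib]
  exact hω

end Deviation

/-! ### The sampling noise of the rewards -/

section Noise

/-- The sum `∑_m p̂_{m,a}² / T_{m,a,o}` in the confidence width. -/
noncomputable def widthSq {n K : ℕ} (A : ℕ → Fin n) (Z : ℕ → Outcome K) (t : ℕ) (a : Fin n) : ℝ :=
  ∑ m, (pHat A Z t m a) ^ 2 / ((obsRounds A Z t m a).card : ℝ)

/-- The part of the error of `μ̂_a` that comes from the observed rewards,
`∑_m p̂_{m,a} (μ̂_{m,a} - μ_{m,a})`. -/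
noncomputable def rewardError {n K : ℕ} (ν : Fin n → Measure (Outcome K)) (A : ℕ → Fin n)
    (Z : ℕ → Outcome K) (t : ℕ) (a : Fin n) : ℝ :=
  ∑ m, pHat A Z t m a * (muHatMed A Z t m a - muMed ν m a)

/-- The values of `(M, O)` at the first `s` pulls of arm `a` are `w 0, w 1, …, w (s - 1)`, in this
order, as far as these pulls occur before round `t`. -/
def Matches {n K s : ℕ} (A : ℕ → Fin n) (Z : ℕ → Outcome K) (t : ℕ) (a : Fin n)
    (w : Fin s → Fin K × Bool) : Prop :=
  ∀ r ∈ armRounds A t a, ∀ h : pulls A r a < s, (med (Z r), obs (Z r)) = w ⟨pulls A r a, h⟩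

section Deterministic

variable {n K s : ℕ} {A : ℕ → Fin n} {Z : ℕ → Outcome K} {t : ℕ} {a : Fin n}

lemma widthSq_nonneg : 0 ≤ widthSq A Z t a :=
  Finset.sum_nonneg fun _ _ => by positivity

lemma exists_matches : ∃ w : Fin s → Fin K × Bool, Matches A Z t a w := by
  set r' : ℕ → ℕ := Function.invFunOn (fun r => pulls A r a) (armRounds A t a : Set ℕ)
  refine ⟨fun i => (med (Z (r' i)), obs (Z (r' i))), fun r hr h => ?_⟩
  have : r' (pulls A r a) = r := (pulls_injOn (A := A)).leftInvOn_invFunOn hr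
  simp only [this]

lemma Matches.sum_eq {w : Fin s → Fin K × Bool} (hw : Matches A Z t a w)
    (hs : pulls A t a = s) (G : Fin K × Bool → ℕ) :
    ∑ r ∈ armRounds A t a, G (med (Z r), obs (Z r)) = ∑ i, G (w i) := by
  have h1 := sum_armRounds_index (A := A) (t := t) (a := a)
    (fun i => if h : i < s then G (w ⟨i, h⟩) else 0)
  rw [hs, Finset.sum_range] at h1
  simp only [Fin.is_lt, dif_pos] at h1
  rw [← h1]
  refine Finset.sum_congr rfl fun r hr => ?_
  have hrs : pulls A r a < s := hs ▸ pulls_lt_of_mem hr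
  rw [dif_pos hrs, hw r hr hrs]

lemma Matches.card_medRounds {w : Fin s → Fin K × Bool} (hw : Matches A Z t a w)
    (hs : pulls A t a = s) (m : Fin K) :
    (medRounds A Z t m a).card = ∑ i, if (w i).1 = m then 1 else 0 := by
  rw [← hw.sum_eq hs fun mo => if mo.1 = m then 1 else 0, medRounds, Finset.card_filter]

lemma card_obsRounds_eq_sum (m : Fin K) : (obsRounds A Z t m a).card
    = ∑ r ∈ armRounds A t a, if (med (Z r), obs (Z r)) = (m, true) then 1 else 0 := by
  rw [obsRounds, medRounds, Finset.filter_filter, Finset.card_filter]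
  simp

lemma Matches.card_obsRounds {w : Fin s → Fin K × Bool} (hw : Matches A Z t a w)
    (hs : pulls A t a = s) (m : Fin K) :
    (obsRounds A Z t m a).card = ∑ i, if w i = (m, true) then 1 else 0 := by
  rw [← hw.sum_eq hs fun mo => if mo = (m, true) then 1 else 0, card_obsRounds_eq_sum]

lemma sum_obsRounds_eq (g : Fin K → ℕ → ℝ) :
    ∑ r ∈ armRounds A t a, (if obs (Z r) = true then g (med (Z r)) r else 0)
      = ∑ m, ∑ r ∈ obsRounds A Z t m a, g m r := by
  simp only [obsRounds, medRounds, Finset.sum_filter]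
  rw [Finset.sum_comm]
  simp

end Deterministic

variable {n K : ℕ} {ν : Fin n → Measure (Outcome K)} {α : ℝ} {T : ℕ}
  {Ω : Type*} [mΩ : MeasurableSpace Ω] {P : Measure Ω} {ℱ : Filtration ℕ mΩ}
  {A : ℕ → Ω → Fin n} {Z : ℕ → Ω → Outcome K} {c : ℝ≥0}

lemma IsMAR.lintegral_exp_le (hν : IsMAR ν) (hsub : IsSubgaussian ν c) (a : Fin n)
    (mo : Fin K × Bool) (θ : ℝ) :
    ∫⁻ z, {z | (med z, obs z) = mo}.indicator (fun z => ENNReal.ofReal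
        (Real.exp (if mo.2 = true then θ * (reward z - muMed ν mo.1 a) else 0))) z ∂ν a
      ≤ ν a {z | (med z, obs z) = mo} *
        ENNReal.ofReal (Real.exp (if mo.2 = true then c * θ ^ 2 / 2 else 0)) := by
  obtain ⟨m, o⟩ := mo
  have := hν.isProbabilityMeasure_condLaw m a
  rw [hν.lintegral_med_obs m a o (G := fun y => ENNReal.ofReal
    (Real.exp (if o = true then θ * (y - muMed ν m a) else 0))) (by split_ifs <;> fun_prop)]
  refine mul_le_mul_right ?_ _
  cases o
  · simp
  · simp only [if_true]
    rw [← ofReal_integral_eq_lintegral_ofReal ((hsub m a).integrable_exp_mul θ)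
        (Eventually.of_forall fun z => Real.exp_nonneg _)]
    exact ENNReal.ofReal_le_ofReal ((hsub m a).mgf_le θ)

/-- The exponential moment of the reward noise on the event that the mediators and observation
indicators of an arm take prescribed values. -/
lemma IsRun.measure_matches_le [IsProbabilityMeasure P] (hν : IsMAR ν)
    (hsub : IsSubgaussian ν c) (h : IsRun ν α T P ℱ A Z) {t : ℕ} (ht : t ≤ T) (a : Fin n)
    {s : ℕ} (w : Fin s → Fin K × Bool) (θ : Fin K → ℝ) (y : ℝ) :
    P {ω | pulls (fun s => A s ω) t a = s ∧ Matches (fun s => A s ω) (fun s => Z s ω) t a w ∧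
        y ≤ ∑ m, ∑ r ∈ obsRounds (fun s => A s ω) (fun s => Z s ω) t m a,
          θ m * (reward (Z r ω) - muMed ν m a)}
      ≤ (∏ i, ν a {z | (med z, obs z) = w i}) * ENNReal.ofReal (Real.exp
        ((∑ i, if (w i).2 = true then c * θ (w i).1 ^ 2 / 2 else 0) - y)) := by
  have := hν.isProb
  set f : ℕ → Outcome K → ℝ≥0∞ := fun i => if hi : i < s then
    {z | (med z, obs z) = w ⟨i, hi⟩}.indicator (fun z => ENNReal.ofReal (Real.exp
      (if (w ⟨i, hi⟩).2 = true then θ (w ⟨i, hi⟩).1 * (reward z - muMed ν (w ⟨i, hi⟩).1 a) else 0)))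
    else 1 with hf
  have hfm : ∀ i, Measurable (f i) := by
    intro i
    by_cases hi : i < s
    · have hm : Measurable fun z : Outcome K => (med z, obs z) := by fun_prop
      simp only [hf, dif_pos hi]
      refine Measurable.indicator ?_ (hm (measurableSet_singleton _))
      split_ifs <;> fun_prop
    · simp only [hf, dif_neg hi]
      exact measurable_const
  refine ofReal_exp_cancel (le_trans ?_ ((h.mul_measure_le ht a hfm s
    (ENNReal.ofReal (Real.exp y))).trans ?_))
  · refine mul_le_mul_right (measure_mono ?_) _
    rintro ω ⟨hω1, hω2, hω3⟩
    refine ⟨hω1, ?_⟩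
    have h1 : ∀ r ∈ armRounds (fun s => A s ω) t a, f (pulls (fun s => A s ω) r a) (Z r ω)
        = ENNReal.ofReal (Real.exp (if obs (Z r ω) = true then
          θ (med (Z r ω)) * (reward (Z r ω) - muMed ν (med (Z r ω)) a) else 0)) := by
      intro r hr
      have hrs : pulls (fun s => A s ω) r a < s := hω1 ▸ pulls_lt_of_mem hr
      have hm := hω2 r hr hrs
      simp only [hf, dif_pos hrs]
      rw [Set.indicator_of_mem (by exact hm), ← hm]
    rw [Finset.prod_congr rfl h1, ← ENNReal.ofReal_prod_of_nonneg fun _ _ => Real.exp_nonneg _,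
      ← Real.exp_sum, sum_obsRounds_eq (A := fun s => A s ω) (Z := fun s => Z s ω)
        (fun m r => θ m * (reward (Z r ω) - muMed ν m a))]
    exact ENNReal.ofReal_le_ofReal (Real.exp_le_exp.2 hω3)
  · rw [Finset.prod_range, Real.exp_sum,
      ENNReal.ofReal_prod_of_nonneg fun _ _ => Real.exp_nonneg _, ← Finset.prod_mul_distrib]
    refine Finset.prod_le_prod' fun i _ => ?_
    simp only [hf, Fin.is_lt, dif_pos]
    exact hν.lintegral_exp_le hsub a (w i) (θ (w i).1)

/-- Given the mediators and the observation indicators, the weights of the rewards in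
`rewardError` are fixed, so it is sub-Gaussian with variance proxy `c * widthSq`. As the weights
depend on the whole sequence of mediators, the bound is proved for each such sequence, and the
probabilities of the sequences add up to one. -/
lemma IsRun.measure_rewardError_gt_le [IsProbabilityMeasure P] (hν : IsMAR ν)
    (hsub : IsSubgaussian ν c) (hc : 0 < c) (h : IsRun ν α T P ℱ A Z) {t : ℕ} (ht : t ≤ T)
    (a : Fin n) {σ : ℝ} (hσ : σ ^ 2 = 1) {x : ℝ} (hx : 0 ≤ x) :
    P {ω | (∀ m, 0 < (obsRounds (fun s => A s ω) (fun s => Z s ω) t m a).card) ∧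
        √(2 * c * x * widthSq (fun s => A s ω) (fun s => Z s ω) t a)
          < σ * rewardError ν (fun s => A s ω) (fun s => Z s ω) t a}
      ≤ (t + 1) * ENNReal.ofReal (Real.exp (-x)) := by
  have := hν.isProb
  have hc' : (0 : ℝ) < c := hc
  refine measure_le_of_pulls (A := A) a fun s => ?_
  set cM : (Fin s → Fin K × Bool) → Fin K → ℕ := fun w m => ∑ i, if (w i).1 = m then 1 else 0
    with hcM
  set cO : (Fin s → Fin K × Bool) → Fin K → ℕ := fun w m => ∑ i, if w i = (m, true) then 1 else 0
    with hcO
  set V : (Fin s → Fin K × Bool) → ℝ := fun w => ∑ m, ((cM w m : ℝ) / s) ^ 2 / cO w m with hV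
  have hV0 : ∀ w, 0 ≤ V w := fun w => Finset.sum_nonneg fun m _ => by positivity
  -- The Chernoff parameter that minimises the bound.
  set l : (Fin s → Fin K × Bool) → ℝ := fun w => √(2 * x / (c * V w)) with hl
  have hl2 : ∀ w, l w ^ 2 = 2 * x / (c * V w) := fun w =>
    Real.sq_sqrt (div_nonneg (by positivity) (mul_nonneg hc'.le (hV0 w)))
  set θ : (Fin s → Fin K × Bool) → Fin K → ℝ := fun w m => σ * l w * ((cM w m : ℝ) / s / cO w m)
    with hθ
  have hexp : ∀ w : Fin s → Fin K × Bool,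
      (∑ i, if (w i).2 = true then (c : ℝ) * θ w (w i).1 ^ 2 / 2 else 0) ≤ x := by
    intro w
    have h1 : (∑ i, if (w i).2 = true then (c : ℝ) * θ w (w i).1 ^ 2 / 2 else 0)
        = ∑ m, (cO w m : ℝ) * ((c : ℝ) * θ w m ^ 2 / 2) := by
      simp only [hcO, Nat.cast_sum, Finset.sum_mul]
      rw [Finset.sum_comm]
      refine Finset.sum_congr rfl fun i _ => ?_
      rcases hwi : w i with ⟨m, o⟩
      cases o <;> simp
    have h2 : ∀ m, (cO w m : ℝ) * ((c : ℝ) * θ w m ^ 2 / 2)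
        = c / 2 * l w ^ 2 * (((cM w m : ℝ) / s) ^ 2 / cO w m) := by
      intro m
      rcases eq_or_ne (cO w m : ℝ) 0 with h0 | h0
      · simp [h0]
      · simp only [hθ, mul_pow, hσ]
        field_simp
    rw [h1, Finset.sum_congr rfl fun m _ => h2 m, ← Finset.mul_sum, hl2]
    rcases (hV0 w).eq_or_lt with h0 | h0
    · simp [← h0, hx]
    · refine le_of_eq ?_
      change c / 2 * (2 * x / (c * V w)) * V w = x
      field_simp
  have hone : ∑ w : Fin s → Fin K × Bool, ∏ i, ν a {z | (med z, obs z) = w i} = 1 := by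
    have h1 := Finset.prod_univ_sum (fun _ : Fin s => (Finset.univ : Finset (Fin K × Bool)))
      (fun _ mo => ν a {z | (med z, obs z) = mo})
    rw [Fintype.piFinset_univ] at h1
    rw [← h1]
    simp [sum_measure_med_obs]
  calc _ ≤ P (⋃ w ∈ (Finset.univ : Finset (Fin s → Fin K × Bool)),
          {ω | pulls (fun s => A s ω) t a = s ∧
            Matches (fun s => A s ω) (fun s => Z s ω) t a w ∧
            2 * x ≤ ∑ m, ∑ r ∈ obsRounds (fun s => A s ω) (fun s => Z s ω) t m a,
              θ w m * (reward (Z r ω) - muMed ν m a)}) := ?_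
    _ ≤ ∑ w, (∏ i, ν a {z | (med z, obs z) = w i}) * ENNReal.ofReal (Real.exp
        ((∑ i, if (w i).2 = true then c * θ w (w i).1 ^ 2 / 2 else 0) - 2 * x)) :=
        (measure_biUnion_finset_le _ _).trans (Finset.sum_le_sum fun w _ =>
          h.measure_matches_le hν hsub ht a w (θ w) (2 * x))
    _ ≤ ∑ w : Fin s → Fin K × Bool, (∏ i, ν a {z | (med z, obs z) = w i}) *
          ENNReal.ofReal (Real.exp (-x)) := by
        refine Finset.sum_le_sum fun w _ => mul_le_mul_right (ENNReal.ofReal_le_ofReal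
          (Real.exp_le_exp.2 ?_)) _
        linarith [hexp w]
    _ = ENNReal.ofReal (Real.exp (-x)) := by rw [← Finset.sum_mul, hone, one_mul]
  refine measure_mono ?_
  rintro ω ⟨hω1, hω2, hω3⟩
  obtain ⟨w, hw⟩ := exists_matches (s := s) (A := fun s => A s ω) (Z := fun s => Z s ω) (t := t) (a := a)
  simp only [Set.mem_iUnion]
  refine ⟨w, Finset.mem_univ _, hω1, hw, ?_⟩
  have hO : ∀ m, (obsRounds (fun s => A s ω) (fun s => Z s ω) t m a).card = cO w m :=
    hw.card_obsRounds hω1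
  have hp : ∀ m, pHat (fun s => A s ω) (fun s => Z s ω) t m a = (cM w m : ℝ) / s := by
    intro m
    rw [pHat, hw.card_medRounds hω1, show (armRounds (fun s => A s ω) t a).card = s from hω1]
  have hVw : widthSq (fun s => A s ω) (fun s => Z s ω) t a = V w := by
    simp only [widthSq, hV, hO, hp]
  have hO0 : ∀ m, (cO w m : ℝ) ≠ 0 := by
    intro m
    have := hω2 m
    rw [hO] at this
    exact_mod_cast this.ne'
  have hsum : ∑ m, ∑ r ∈ obsRounds (fun s => A s ω) (fun s => Z s ω) t m a,
        θ w m * (reward (Z r ω) - muMed ν m a)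
      = l w * (σ * rewardError ν (fun s => A s ω) (fun s => Z s ω) t a) := by
    simp only [rewardError, Finset.mul_sum]
    refine Finset.sum_congr rfl fun m _ => ?_
    have := hO0 m
    rw [← Finset.mul_sum, Finset.sum_sub_distrib, Finset.sum_const, nsmul_eq_mul, muHatMed, hp, hO]
    simp only [hθ]
    field_simp
  rw [hsum]
  rw [hVw] at hω3
  have hVpos : 0 < V w := by
    refine (hV0 w).lt_of_ne fun h0 => ?_
    have h1 : ∀ m, (cM w m : ℝ) / s = 0 := by
      intro m
      have := (Finset.sum_eq_zero_iff_of_nonneg fun m _ => by positivity).1 h0.symm m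
        (Finset.mem_univ m)
      rcases div_eq_zero_iff.1 this with h2 | h2
      · exact pow_eq_zero_iff (two_ne_zero) |>.1 h2
      · exact absurd h2 (hO0 m)
    have h2 : rewardError ν (fun s => A s ω) (fun s => Z s ω) t a = 0 := by
      simp [rewardError, hp, h1]
    rw [h2, mul_zero] at hω3
    exact absurd hω3 (not_lt.2 (Real.sqrt_nonneg _))
  have hlx : l w * √(2 * c * x * V w) = 2 * x := by
    simp only [hl]
    rw [← Real.sqrt_mul (by positivity),
      show 2 * x / (c * V w) * (2 * c * x * V w) = (2 * x) ^ 2 by field_simp]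
    exact Real.sqrt_sq (by positivity)
  rw [← hlx]
  exact mul_le_mul_of_nonneg_left hω3.le (Real.sqrt_nonneg _)

lemma IsRun.measure_abs_rewardError_gt_le [IsProbabilityMeasure P] (hν : IsMAR ν)
    (hsub : IsSubgaussian ν c) (hc : 0 < c) (h : IsRun ν α T P ℱ A Z) {t : ℕ} (ht : t ≤ T)
    (a : Fin n) {x : ℝ} (hx : 0 ≤ x) :
    P {ω | (∀ m, 0 < (obsRounds (fun s => A s ω) (fun s => Z s ω) t m a).card) ∧
        √(2 * c * x * widthSq (fun s => A s ω) (fun s => Z s ω) t a)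
          < |rewardError ν (fun s => A s ω) (fun s => Z s ω) t a|}
      ≤ (t + 1) * (2 * ENNReal.ofReal (Real.exp (-x))) := by
  have h1 := h.measure_rewardError_gt_le hν hsub hc ht a (σ := 1) (by norm_num) hx
  have h2 := h.measure_rewardError_gt_le hν hsub hc ht a (σ := -1) (by norm_num) hx
  calc _ ≤ _ := measure_mono (?_ : _ ⊆ {ω | _} ∪ {ω | _})
    _ ≤ _ := (measure_union_le _ _).trans (add_le_add h1 h2)
    _ = _ := by ring
  rintro ω ⟨hω1, hω2⟩
  rw [lt_abs] at hω2
  rcases hω2 with h3 | h3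
  · exact Or.inl ⟨hω1, by rwa [one_mul]⟩
  · exact Or.inr ⟨hω1, by rwa [neg_one_mul]⟩

end Noise

/-! ### Means of the arms -/

section Means

variable {n K : ℕ} {ν : Fin n → Measure (Outcome K)} {c : ℝ≥0}

lemma integral_eq_sum_med {a : Fin n} {f : Outcome K → ℝ}
    (hf : ∀ m, IntegrableOn f {z | med z = m} (ν a)) :
    ∫ z, f z ∂ν a = ∑ m, ∫ z in {z | med z = m}, f z ∂ν a := by
  have h1 : ∀ z, f z = ∑ m, {z : Outcome K | med z = m}.indicator f z := by
    intro z
    simp [Set.indicator_apply]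
  simp_rw [← fun m => integral_indicator (μ := ν a) (f := f) (measurableSet_med m)]
  rw [← integral_finsetSum _ fun m _ => (integrable_indicator_iff (measurableSet_med m)).2 (hf m)]
  exact integral_congr_ae (Eventually.of_forall h1)

lemma IsMAR.integral_muMed (hν : IsMAR ν) (a : Fin n) :
    ∫ z, muMed ν (med z) a ∂ν a = ∑ m, pMed ν m a * muMed ν m a := by
  have := hν.isProb a
  have h1 : ∀ m, Set.EqOn (fun z : Outcome K => muMed ν (med z) a) (fun _ => muMed ν m a)
      {z | med z = m} := by
    intro m z hz
    have hz' : med z = m := hz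
    simp only [hz']
  rw [integral_eq_sum_med fun m =>
    (integrableOn_const (by finiteness)).congr_fun (h1 m).symm (measurableSet_med m)]
  refine Finset.sum_congr rfl fun m _ => ?_
  rw [setIntegral_congr_fun (measurableSet_med m) (h1 m), setIntegral_const, smul_eq_mul, pMed]

/-- The law of total expectation: `μ_a = E[μ_{M,a}]`. -/
lemma IsMAR.mu_eq (hν : IsMAR ν) (hsub : IsSubgaussian ν c) (a : Fin n) :
    mu ν a = ∫ z, muMed ν (med z) a ∂ν a := by
  have := hν.isProb a
  have hint : ∀ m, Integrable (reward (K := K)) (condLaw ν m a) := by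
    intro m
    have := hν.isProbabilityMeasure_condLaw m a
    have h1 := (hsub m a).integrable.add (integrable_const (muMed ν m a))
    exact h1.congr (Eventually.of_forall fun z => by simp)
  rw [hν.integral_muMed, mu, integral_eq_sum_med fun m => ?_]
  · refine Finset.sum_congr rfl fun m _ => ?_
    rw [hν.restrict_eq_smul_condLaw, integral_smul_measure, smul_eq_mul, muMed, pMed,
      measureReal_def]
  · rw [IntegrableOn, hν.restrict_eq_smul_condLaw]
    exact (hint m).smul_measure (by finiteness)

lemma IsMAR.mu_mem (hν : IsMAR ν) (hsub : IsSubgaussian ν c) (a : Fin n) :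
    mu ν a ∈ Set.Icc (0 : ℝ) 1 := by
  have := hν.isProb a
  rw [hν.mu_eq hsub]
  have hm : Measurable fun z : Outcome K => muMed ν (med z) a :=
    (Measurable.of_discrete (f := fun m => muMed ν m a)).comp measurable_med
  refine ⟨integral_nonneg fun z => (hν.mean_mem _ a).1, ?_⟩
  calc ∫ z, muMed ν (med z) a ∂ν a ≤ ∫ z, (1 : ℝ) ∂ν a :=
        integral_mono_of_nonneg (Eventually.of_forall fun z => (hν.mean_mem _ a).1)
          (integrable_const 1) (Eventually.of_forall fun z => (hν.mean_mem _ a).2)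
    _ = 1 := by simp

lemma IsMAR.gam_le_one (hν : IsMAR ν) (m : Fin K) (a : Fin n) : gam ν m a ≤ 1 :=
  have := hν.isProbabilityMeasure_condLaw m a
  measureReal_le_one

lemma IsMAR.measureReal_med_obs (hν : IsMAR ν) (m : Fin K) (a : Fin n) :
    (ν a).real {z | (med z, obs z) = (m, true)} = pMed ν m a * gam ν m a := by
  rw [measureReal_def, hν.measure_med_obs, ENNReal.toReal_mul]
  rfl

lemma IsMAR.sum_pMed (hν : IsMAR ν) (a : Fin n) : ∑ m, pMed ν m a = 1 := by
  have := hν.isProb a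
  have h1 := integral_eq_sum_med (ν := ν) (a := a) (f := fun _ => (1 : ℝ))
    fun m => integrableOn_const (by finiteness)
  simpa [pMed] using h1.symm

lemma IsMAR.one_le_Psum (hν : IsMAR ν) (a : Fin n) : 1 ≤ Psum ν a := by
  rw [← hν.sum_pMed a]
  refine Finset.sum_le_sum fun m _ => ?_
  rw [le_div_iff₀ (hν.gam_pos m a)]
  exact mul_le_of_le_one_right (hν.pMed_pos m a).le (hν.gam_le_one m a)

lemma n_mul_Smean (hn : 1 ≤ n) : n * Smean ν = ∑ a, Psum ν a := by
  have : (n : ℝ) ≠ 0 := by positivity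
  rw [Smean]
  field_simp

lemma IsMAR.Psum_le (hν : IsMAR ν) (hn : 1 ≤ n) (a : Fin n) : Psum ν a ≤ n * Smean ν := by
  rw [n_mul_Smean hn]
  exact Finset.single_le_sum (f := fun a => Psum ν a)
    (fun b _ => zero_le_one.trans (hν.one_le_Psum b)) (Finset.mem_univ a)

end Means

/-! ### The concentration event -/

section Concentration

/-- The estimates for arm `a` in round `t` are accurate at level `x`: the frequencies of `M = m`
and of `M = m, O = 1`, the average of `μ_{M,a}`, and the average of the observed rewards. -/
structure Concentrated {n K : ℕ} (ν : Fin n → Measure (Outcome K)) (c : ℝ≥0) (x : ℝ)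
    (A : ℕ → Fin n) (Z : ℕ → Outcome K) (t : ℕ) (a : Fin n) : Prop where
  med_le : ∀ m, |∑ r ∈ armRounds A t a, ((if med (Z r) = m then 1 else 0) - pMed ν m a)|
    ≤ √(pulls A t a * x / 2)
  obs_le : ∀ m, |∑ r ∈ armRounds A t a, ((if (med (Z r), obs (Z r)) = (m, true) then 1 else 0)
    - pMed ν m a * gam ν m a)| ≤ √(pulls A t a * x / 2)
  mean_le : |∑ r ∈ armRounds A t a, (muMed ν (med (Z r)) a - mu ν a)| ≤ √(pulls A t a * x / 2)
  reward_le : (∀ m, 0 < (obsRounds A Z t m a).card) →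
    |rewardError ν A Z t a| ≤ √(2 * c * x * widthSq A Z t a)

variable {n K : ℕ} {ν : Fin n → Measure (Outcome K)} {c : ℝ≥0}

lemma IsRun.measure_not_concentrated_le {α : ℝ} {T : ℕ}
    {Ω : Type*} [mΩ : MeasurableSpace Ω] {P : Measure Ω} [IsProbabilityMeasure P]
    {ℱ : Filtration ℕ mΩ} {A : ℕ → Ω → Fin n} {Z : ℕ → Ω → Outcome K} (hν : IsMAR ν)
    (hsub : IsSubgaussian ν c) (hc : 0 < c) (h : IsRun ν α T P ℱ A Z) {t : ℕ} (ht : t ≤ T)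
    (a : Fin n) {x : ℝ} (hx : 0 ≤ x) :
    P {ω | ¬ Concentrated ν c x (fun s => A s ω) (fun s => Z s ω) t a}
      ≤ (2 * K + 2) * ((t + 1) * (2 * ENNReal.ofReal (Real.exp (-x)))) := by
  have := hν.isProb
  set b := ((t : ℝ≥0∞) + 1) * (2 * ENNReal.ofReal (Real.exp (-x))) with hb
  have hmed : ∀ m, P {ω | √(pulls (fun s => A s ω) t a * x / 2) <
      |∑ r ∈ armRounds (fun s => A s ω) t a,
        ((if med (Z r ω) = m then 1 else 0) - pMed ν m a)|} ≤ b := by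
    intro m
    have h1 := h.measure_abs_sum_gt_le ht a
      (f := {z : Outcome K | med z = m}.indicator fun _ => (1 : ℝ))
      (measurable_const.indicator (measurableSet_med m))
      (fun z => by by_cases hz : med z = m <;> simp [hz]) hx
    rw [integral_indicator (measurableSet_med m), setIntegral_const] at h1
    simpa [Set.indicator_apply, pMed] using h1
  have hobs : ∀ m, P {ω | √(pulls (fun s => A s ω) t a * x / 2) <
      |∑ r ∈ armRounds (fun s => A s ω) t a,
        ((if (med (Z r ω), obs (Z r ω)) = (m, true) then 1 else 0)
          - pMed ν m a * gam ν m a)|} ≤ b := by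
    intro m
    have hm : MeasurableSet {z : Outcome K | (med z, obs z) = (m, true)} :=
      (measurable_med.prodMk measurable_obs) (measurableSet_singleton _)
    have h1 := h.measure_abs_sum_gt_le ht a
      (f := {z : Outcome K | (med z, obs z) = (m, true)}.indicator fun _ => (1 : ℝ))
      (measurable_const.indicator hm)
      (fun z => by
        rw [Set.indicator_apply]
        split_ifs <;> simp) hx
    rw [integral_indicator hm, setIntegral_const, hν.measureReal_med_obs] at h1
    simpa only [Set.indicator_apply, smul_eq_mul, mul_one, Set.mem_ofPred_eq] using h1
  have hmean : P {ω | √(pulls (fun s => A s ω) t a * x / 2) <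
      |∑ r ∈ armRounds (fun s => A s ω) t a, (muMed ν (med (Z r ω)) a - mu ν a)|} ≤ b := by
    have h1 := h.measure_abs_sum_gt_le ht a (f := fun z => muMed ν (med z) a)
      ((Measurable.of_discrete (f := fun m => muMed ν m a)).comp measurable_med)
      (fun z => hν.mean_mem _ a) hx
    rwa [← hν.mu_eq hsub] at h1
  have hrew := h.measure_abs_rewardError_gt_le hν hsub hc ht a hx
  calc _ ≤ P (((⋃ m ∈ (Finset.univ : Finset (Fin K)), {ω | _}) ∪
          (⋃ m ∈ (Finset.univ : Finset (Fin K)), {ω | _})) ∪ ({ω | _} ∪ {ω | _})) :=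
        measure_mono ?_
    _ ≤ (∑ m : Fin K, b + ∑ m : Fin K, b) + (b + b) := by
        refine (measure_union_le _ _).trans (add_le_add
          ((measure_union_le _ _).trans (add_le_add ?_ ?_))
          ((measure_union_le _ _).trans (add_le_add hmean hrew)))
        · exact (measure_biUnion_finset_le _ _).trans (Finset.sum_le_sum fun m _ => hmed m)
        · exact (measure_biUnion_finset_le _ _).trans (Finset.sum_le_sum fun m _ => hobs m)
    _ = (2 * K + 2) * b := by
        simp only [Finset.sum_const, Finset.card_univ, Fintype.card_fin, nsmul_eq_mul]
        ring
  intro ω hω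
  by_contra hcon
  simp only [Set.mem_union, Set.mem_iUnion, Set.mem_ofPred_eq, not_or, not_exists, not_lt,
    not_and] at hcon
  exact hω ⟨fun m => hcon.1.1 m (Finset.mem_univ m), fun m => hcon.1.2 m (Finset.mem_univ m),
    hcon.2.1, hcon.2.2⟩

variable {A : ℕ → Fin n} {Z : ℕ → Outcome K} {t : ℕ} {a : Fin n} {x : ℝ}

lemma card_medRounds_eq_sum (m : Fin K) : ((medRounds A Z t m a).card : ℝ)
    = ∑ r ∈ armRounds A t a, if med (Z r) = m then 1 else 0 := by
  rw [medRounds, Finset.card_filter]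
  push_cast
  rfl

lemma card_obsRounds_le (m : Fin K) :
    ((obsRounds A Z t m a).card : ℝ) ≤ (medRounds A Z t m a).card := by
  exact_mod_cast Finset.card_filter_le _ _

lemma sum_med_armRounds (g : Fin K → ℝ) :
    ∑ r ∈ armRounds A t a, g (med (Z r)) = ∑ m, (medRounds A Z t m a).card * g m := by
  simp only [card_medRounds_eq_sum, Finset.sum_mul]
  rw [Finset.sum_comm]
  simp

lemma sum_card_medRounds : ∑ m, ((medRounds A Z t m a).card : ℝ) = pulls A t a := by
  have := sum_med_armRounds (A := A) (Z := Z) (t := t) (a := a) (fun _ => 1)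
  simpa using this.symm

/-- Arm `a` has been pulled so often before round `t` that deviations at level `x` leave its
empirical frequencies within a factor of two of the probabilities. -/
def Explored (ν : Fin n → Measure (Outcome K)) (x : ℝ) (A : ℕ → Fin n) (t : ℕ) (a : Fin n) :
    Prop :=
  0 < pulls A t a ∧ ∀ m, 2 * x ≤ pulls A t a * (pMed ν m a * gam ν m a) ^ 2

lemma Explored.sqrt_le (hν : IsMAR ν) (hk : Explored ν x A t a) (m : Fin K) :
    √(pulls A t a * x / 2) ≤ pulls A t a * (pMed ν m a * gam ν m a / 2) := by
  have h1 := hν.pMed_pos m a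
  have h2 := hν.gam_pos m a
  refine Real.sqrt_le_iff.2 ⟨by positivity, ?_⟩
  have := mul_le_mul_of_nonneg_left (hk.2 m) (Nat.cast_nonneg (α := ℝ) (pulls A t a))
  nlinarith

lemma Concentrated.le_card_obsRounds (hν : IsMAR ν) (h : Concentrated ν c x A Z t a)
    (hk : Explored ν x A t a) (m : Fin K) :
    pulls A t a * (pMed ν m a * gam ν m a / 2) ≤ (obsRounds A Z t m a).card := by
  have h1 := (abs_le.1 ((h.obs_le m).trans (hk.sqrt_le hν m))).1
  rw [Finset.sum_sub_distrib, Finset.sum_const, nsmul_eq_mul] at h1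
  have h2 := card_obsRounds_eq_sum (A := A) (Z := Z) (t := t) (a := a) m
  have h3 : ((obsRounds A Z t m a).card : ℝ) = ∑ r ∈ armRounds A t a,
      if (med (Z r), obs (Z r)) = (m, true) then 1 else 0 := by
    rw [h2]
    push_cast
    rfl
  rw [h3]
  linarith

lemma Concentrated.card_obsRounds_pos (hν : IsMAR ν) (h : Concentrated ν c x A Z t a)
    (hk : Explored ν x A t a) (m : Fin K) : 0 < (obsRounds A Z t m a).card := by
  have h1 := h.le_card_obsRounds hν hk m
  have h2 := hν.pMed_pos m a
  have h3 := hν.gam_pos m a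
  have h4 : (0 : ℝ) < pulls A t a := by exact_mod_cast hk.1
  have h5 : (0 : ℝ) < pulls A t a * (pMed ν m a * gam ν m a / 2) := by positivity
  exact_mod_cast h5.trans_le h1

lemma Concentrated.pHat_le (hν : IsMAR ν) (h : Concentrated ν c x A Z t a)
    (hk : Explored ν x A t a) (m : Fin K) : pHat A Z t m a ≤ 2 * pMed ν m a := by
  have h1 := (abs_le.1 ((h.med_le m).trans (hk.sqrt_le hν m))).2
  rw [Finset.sum_sub_distrib, Finset.sum_const, nsmul_eq_mul, ← card_medRounds_eq_sum] at h1
  have h4 : (0 : ℝ) < pulls A t a := by exact_mod_cast hk.1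
  have h5 := mul_le_of_le_one_right (hν.pMed_pos m a).le (hν.gam_le_one m a)
  have h6 := hν.pMed_pos m a
  rw [pHat, div_le_iff₀ h4]
  nlinarith

lemma Concentrated.widthSq_le (hν : IsMAR ν) (h : Concentrated ν c x A Z t a)
    (hk : Explored ν x A t a) : widthSq A Z t a ≤ 8 * Psum ν a / pulls A t a := by
  have h4 : (0 : ℝ) < pulls A t a := by exact_mod_cast hk.1
  rw [widthSq, Psum, mul_div_assoc, Finset.sum_div, Finset.mul_sum]
  refine Finset.sum_le_sum fun m _ => ?_
  have h2 := hν.pMed_pos m a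
  have h3 := hν.gam_pos m a
  have h5 : 0 ≤ pHat A Z t m a := by
    rw [pHat]
    positivity
  calc _ ≤ (2 * pMed ν m a) ^ 2 / (pulls A t a * (pMed ν m a * gam ν m a / 2)) :=
        div_le_div₀ (by positivity) (pow_le_pow_left₀ h5 (h.pHat_le hν hk m) 2) (by positivity)
          (h.le_card_obsRounds hν hk m)
    _ = _ := by
        field_simp
        ring

/-- Observing only part of the rewards cannot reduce the width below that of a full sample. -/
lemma one_div_pulls_le_widthSq (hpos : ∀ m, 0 < (obsRounds A Z t m a).card) :
    1 / (pulls A t a : ℝ) ≤ widthSq A Z t a := by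
  rcases Nat.eq_zero_or_pos (pulls A t a) with h0 | h0
  · rw [h0]
    simpa using widthSq_nonneg
  have h4 : (0 : ℝ) < pulls A t a := by exact_mod_cast h0
  have h5 : 1 / (pulls A t a : ℝ)
      = ∑ m, ((medRounds A Z t m a).card : ℝ) / (pulls A t a : ℝ) ^ 2 := by
    rw [← Finset.sum_div, sum_card_medRounds]
    field_simp
  rw [h5, widthSq]
  refine Finset.sum_le_sum fun m _ => ?_
  have h6 : (0 : ℝ) < (obsRounds A Z t m a).card := by exact_mod_cast hpos m
  rw [pHat, le_div_iff₀ h6, div_pow, div_mul_eq_mul_div]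
  refine div_le_div_of_nonneg_right ?_ (by positivity)
  rw [sq]
  exact mul_le_mul_of_nonneg_left (card_obsRounds_le m) (by positivity)

/-- The error of `μ̂_a` is the sum of the error of the rewards and of the error of the
frequencies of the mediator. -/
lemma muHat_sub_mu (hk : 0 < pulls A t a) : muHat A Z t a - mu ν a = rewardError ν A Z t a +
    1 / (pulls A t a : ℝ) * ∑ r ∈ armRounds A t a, (muMed ν (med (Z r)) a - mu ν a) := by
  have h4 : (pulls A t a : ℝ) ≠ 0 := by exact_mod_cast hk.ne'
  have h1 : muHat A Z t a = ∑ m, pHat A Z t m a * muHatMed A Z t m a := by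
    rw [muHat]
    simp only [Finset.sum_ite_eq, Finset.mem_univ, if_true]
    rw [sum_med_armRounds (fun m => muHatMed A Z t m a), Finset.mul_sum]
    refine Finset.sum_congr rfl fun m _ => ?_
    rw [pHat]
    ring
  have h2 : 1 / (pulls A t a : ℝ) * ∑ r ∈ armRounds A t a, (muMed ν (med (Z r)) a - mu ν a)
      = ∑ m, pHat A Z t m a * muMed ν m a - mu ν a := by
    rw [Finset.sum_sub_distrib, sum_med_armRounds (fun m => muMed ν m a), Finset.sum_const,
      nsmul_eq_mul, mul_sub, Finset.mul_sum]
    congr 1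
    · refine Finset.sum_congr rfl fun m _ => ?_
      rw [pHat]
      ring
    · field_simp
  rw [h1, h2, rewardError]
  simp only [mul_sub, Finset.sum_sub_distrib]
  ring

lemma Concentrated.abs_muHat_sub_le (hν : IsMAR ν) (hx : 0 ≤ x)
    (h : Concentrated ν c x A Z t a) (hk : Explored ν x A t a) :
    |muHat A Z t a - mu ν a| ≤ (√(2 * c) + √(1 / 2)) * √(x * widthSq A Z t a) := by
  have h4 : (0 : ℝ) < pulls A t a := by exact_mod_cast hk.1
  have hV := widthSq_nonneg (A := A) (Z := Z) (t := t) (a := a)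
  have hpos := h.card_obsRounds_pos hν hk
  rw [muHat_sub_mu hk.1, add_mul]
  refine (abs_add_le _ _).trans (add_le_add ?_ ?_)
  · refine (h.reward_le hpos).trans (le_of_eq ?_)
    rw [← Real.sqrt_mul (by positivity), mul_assoc (2 * (c : ℝ))]
  · rw [abs_mul, abs_of_pos (by positivity), ← Real.sqrt_mul (by positivity)]
    refine (mul_le_mul_of_nonneg_left h.mean_le (by positivity)).trans ?_
    refine Real.le_sqrt_of_sq_le ?_
    rw [mul_pow, Real.sq_sqrt (by positivity)]
    have := mul_le_mul_of_nonneg_left (one_div_pulls_le_widthSq hpos) hx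
    calc _ = 1 / 2 * (x * (1 / (pulls A t a : ℝ))) := by field_simp
      _ ≤ _ := by linarith

end Concentration

/-! ### Regret of an accurately estimated run -/

section Regret

variable {n K : ℕ} {ν : Fin n → Measure (Outcome K)} {c : ℝ≥0}
  {A : ℕ → Fin n} {Z : ℕ → Outcome K}

lemma mu_le_iSup (a : Fin n) : mu ν a ≤ ⨆ b, mu ν b :=
  le_ciSup (Set.finite_range _).bddAbove a

lemma IsMAR.iSup_sub_mu_le_one (hν : IsMAR ν) (hsub : IsSubgaussian ν c) (a : Fin n) :
    (⨆ b, mu ν b) - mu ν a ≤ 1 := by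
  have : Nonempty (Fin n) := ⟨a⟩
  have h1 : (⨆ b, mu ν b) ≤ 1 := ciSup_le fun b => (hν.mu_mem hsub b).2
  linarith [(hν.mu_mem hsub a).1]

lemma pulls_succ_eq_add (A : ℕ → Fin n) (t : ℕ) (a : Fin n) :
    pulls A (t + 1) a = pulls A t a + if A t = a then 1 else 0 := by
  split_ifs with h
  · exact pulls_succ_of_eq h
  · exact pulls_succ_of_ne h

lemma one_div_sqrt_le {k : ℝ} (hk : 1 ≤ k) : 1 / √k ≤ 3 * (√(k + 1) - √k) := by
  have h0 : 0 < √k := Real.sqrt_pos.2 (by linarith)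
  have h1 : √k ^ 2 = k := Real.sq_sqrt (by linarith)
  have h2 : √(k + 1) ≤ 2 * √k := by
    refine Real.sqrt_le_iff.2 ⟨by positivity, ?_⟩
    nlinarith
  have h3 : √(k + 1) ^ 2 = k + 1 := Real.sq_sqrt (by linarith)
  have h4 : √k ≤ √(k + 1) := Real.sqrt_le_sqrt (by linarith)
  rw [div_le_iff₀ h0]
  nlinarith

/-- If a loss of `κ √(w_a / k)` is incurred at the pull of arm `a` with index `k`, the total loss
is governed by the potential `∑_a √(w_a T_a)`, which the inequality of Cauchy and Schwarz bounds
by `√(T ∑_a w_a)`. -/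
lemma sum_loss_le {g w : Fin n → ℝ} {κ : ℝ} {T I : ℕ} (hw : ∀ a, 0 ≤ w a) (hκ : 0 ≤ κ)
    (hg1 : ∀ a, g a ≤ 1)
    (hg : ∀ t < T, I ≤ t → 0 < pulls A t (A t) ∧ g (A t) ≤ κ * √(w (A t) / pulls A t (A t))) :
    ∑ t ∈ Finset.range T, g (A t) ≤ I + 3 * κ * √((∑ a, w a) * T) := by
  have key : ∀ t ≤ T, ∑ r ∈ Finset.range t, g (A r)
      ≤ ∑ r ∈ Finset.range t, (if r < I then 1 else 0)
        + 3 * κ * ∑ a, √(w a) * √(pulls A t a) := by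
    intro t
    induction t with
    | zero =>
      intro _
      simp [pulls, armRounds]
    | succ t ih =>
      intro ht
      have ih' := ih (by omega)
      rw [Finset.sum_range_succ, Finset.sum_range_succ]
      have hpot : ∑ a, √(w a) * √(pulls A (t + 1) a) = ∑ a, √(w a) * √(pulls A t a)
          + √(w (A t)) * (√(pulls A t (A t) + 1) - √(pulls A t (A t))) := by
        have h1 : ∀ a, √(w a) * √(pulls A (t + 1) a) = √(w a) * √(pulls A t a) +
            if A t = a then √(w a) * (√(pulls A t a + 1) - √(pulls A t a)) else 0 := by
          intro a
          rw [pulls_succ_eq_add]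
          split_ifs with h
          · push_cast
            ring
          · simp
        simp_rw [h1, Finset.sum_add_distrib]
        simp
      have hmono : √(pulls A t (A t) : ℝ) ≤ √(pulls A t (A t) + 1) :=
        Real.sqrt_le_sqrt (by linarith)
      have hnn : 0 ≤ √(w (A t)) * (√(pulls A t (A t) + 1) - √(pulls A t (A t))) :=
        mul_nonneg (Real.sqrt_nonneg _) (by linarith)
      rw [hpot, mul_add]
      by_cases hI : t < I
      · rw [if_pos hI]
        have := hg1 (A t)
        have : 0 ≤ 3 * κ * (√(w (A t)) * (√(pulls A t (A t) + 1) - √(pulls A t (A t)))) := by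
          positivity
        linarith
      · rw [if_neg hI]
        obtain ⟨h1, h2⟩ := hg t (by omega) (by omega)
        have h3 := one_div_sqrt_le (k := pulls A t (A t)) (by exact_mod_cast h1)
        have h4 := mul_le_mul_of_nonneg_left h3 (mul_nonneg hκ (Real.sqrt_nonneg (w (A t))))
        rw [Real.sqrt_div (hw _)] at h2
        have h5 : κ * (√(w (A t)) / √(pulls A t (A t) : ℝ))
            = κ * √(w (A t)) * (1 / √(pulls A t (A t) : ℝ)) := by ring
        linarith
  refine (key T le_rfl).trans (add_le_add ?_ (mul_le_mul_of_nonneg_left ?_ (by positivity)))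
  · rw [← Finset.sum_filter, Finset.sum_const, nsmul_eq_mul, mul_one]
    have : {r ∈ Finset.range T | r < I} ⊆ Finset.range I := by
      intro r hr
      simpa using (Finset.mem_filter.1 hr).2
    exact_mod_cast (Finset.card_le_card this).trans (by simp)
  · have h1 := Real.sum_sqrt_mul_sqrt_le (Finset.univ : Finset (Fin n)) (f := w)
      (g := fun a => (pulls A T a : ℝ)) hw (fun a => by positivity)
    refine h1.trans (le_of_eq ?_)
    rw [← Real.sqrt_mul (Finset.sum_nonneg fun a _ => hw a)]
    congr 2
    exact_mod_cast sum_pulls A T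

variable {α : ℝ} {T t : ℕ}

lemma ucb_eq (a : Fin n) : ucb A Z t α T a
    = muHat A Z t a + √8 * √(4 * α * Real.log T * widthSq A Z t a) := by
  rw [ucb, ← widthSq]
  congr 1
  have h1 : (8 : ℝ) = √(8 ^ 2) := (Real.sqrt_sq (by norm_num)).symm
  have h2 : ∀ y : ℝ, 8 * √y = √(8 ^ 2 * y) := fun y => by
    rw [Real.sqrt_mul (by norm_num), ← h1]
  rw [h2, ← Real.sqrt_mul (by norm_num)]
  congr 1
  ring

/-- For variance proxy `1` the confidence bounds hold, so that the gap of the chosen arm is at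
most twice its confidence width. -/
lemma mu_sub_mu_le_of_greedy (hν : IsMAR ν) (hx : 0 ≤ 4 * α * Real.log T)
    (hcon : ∀ a, Concentrated ν 1 (4 * α * Real.log T) A Z t a)
    (hexp : ∀ a, Explored ν (4 * α * Real.log T) A t a)
    (hgr : ∀ b, ucb A Z t α T b ≤ ucb A Z t α T (A t)) (b : Fin n) :
    mu ν b - mu ν (A t)
      ≤ 16 * √(4 * α * Real.log T) * √(Psum ν (A t) / pulls A t (A t)) := by
  set x := 4 * α * Real.log T with hxdef
  -- The numerical inequality `√2 + √(1/2) ≤ √8` is what makes the index optimistic.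
  have hnum : √(2 * ((1 : ℝ≥0) : ℝ)) + √(1 / 2) ≤ √8 := by
    have h1 : √(2 * ((1 : ℝ≥0) : ℝ)) = √2 := by simp
    have h2 : √(8 : ℝ) = 2 * √2 := by
      rw [show (8 : ℝ) = 2 ^ 2 * 2 by norm_num, Real.sqrt_mul (by norm_num),
        Real.sqrt_sq (by norm_num)]
    have h3 : √(1 / 2 : ℝ) ≤ √2 := Real.sqrt_le_sqrt (by norm_num)
    rw [h1, h2]
    linarith
  have herr : ∀ a, |muHat A Z t a - mu ν a| ≤ √8 * √(x * widthSq A Z t a) := fun a =>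
    ((hcon a).abs_muHat_sub_le hν hx (hexp a)).trans
      (mul_le_mul_of_nonneg_right hnum (Real.sqrt_nonneg _))
  have h1 := hgr b
  rw [ucb_eq, ucb_eq, ← hxdef] at h1
  have h2 := (abs_le.1 (herr b)).1
  have h3 := (abs_le.1 (herr (A t))).2
  have h4 : √8 * √(x * widthSq A Z t (A t))
      ≤ 8 * √x * √(Psum ν (A t) / pulls A t (A t)) := by
    have h5 : (8 : ℝ) = √(8 ^ 2) := (Real.sqrt_sq (by norm_num)).symm
    calc √8 * √(x * widthSq A Z t (A t))
        ≤ √8 * √(x * (8 * Psum ν (A t) / pulls A t (A t))) := by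
          gcongr
          exact (hcon (A t)).widthSq_le hν (hexp (A t))
      _ = √(8 ^ 2 * x * (Psum ν (A t) / pulls A t (A t))) := by
          rw [← Real.sqrt_mul (by norm_num)]
          congr 1
          ring
      _ = _ := by
          rw [Real.sqrt_mul (by positivity), Real.sqrt_mul (by positivity), ← h5]
  linarith

/-- For any variance proxy, the gap of the chosen arm is small once every arm has been pulled
often enough. -/
lemma mu_sub_mu_le_of_widthSq_le (hν : IsMAR ν) (hx : 0 ≤ 4 * α * Real.log T) {W : ℝ}
    (hcon : ∀ a, Concentrated ν c (4 * α * Real.log T) A Z t a)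
    (hexp : ∀ a, Explored ν (4 * α * Real.log T) A t a)
    (hW : ∀ a, 4 * α * Real.log T * widthSq A Z t a ≤ W)
    (hgr : ∀ b, ucb A Z t α T b ≤ ucb A Z t α T (A t)) (b : Fin n) :
    mu ν b - mu ν (A t) ≤ (2 * (√(2 * c) + √(1 / 2)) + √8) * √W := by
  have herr : ∀ a, |muHat A Z t a - mu ν a| ≤ (√(2 * c) + √(1 / 2)) * √W := fun a =>
    ((hcon a).abs_muHat_sub_le hν hx (hexp a)).trans
      (mul_le_mul_of_nonneg_left (Real.sqrt_le_sqrt (hW a)) (by positivity))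
  have h1 := hgr b
  rw [ucb_eq, ucb_eq] at h1
  have h2 := (abs_le.1 (herr b)).1
  have h3 := (abs_le.1 (herr (A t))).2
  have h4 := mul_le_mul_of_nonneg_left (Real.sqrt_le_sqrt (hW (A t))) (Real.sqrt_nonneg 8)
  have h5 : 0 ≤ √8 * √(4 * α * Real.log T * widthSq A Z t b) := by positivity
  linarith

end Regret

/-! ### Expected regret -/

section ExpectedRegret

variable {n K : ℕ} {ν : Fin n → Measure (Outcome K)} {c : ℝ≥0} {α : ℝ} {T : ℕ}
  {Ω : Type*} [mΩ : MeasurableSpace Ω] {P : Measure Ω} {ℱ : Filtration ℕ mΩ}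
  {A : ℕ → Ω → Fin n} {Z : ℕ → Ω → Outcome K}

/-- After the initial rounds, every arm has been pulled `initPulls T` times. -/
lemma IsRun.initPulls_le_pulls (h : IsRun ν α T P ℱ A Z) {t : ℕ} (ht : t < T)
    (hI : n * initPulls T ≤ t) (ω : Ω) (a : Fin n) :
    initPulls T ≤ pulls (fun s => A s ω) t a := by
  have hsub : Finset.Ico (a * initPulls T) ((a + 1) * initPulls T)
      ⊆ armRounds (fun s => A s ω) t a := by
    intro r hr
    rw [Finset.mem_Ico] at hr
    have h1 : (a + 1) * initPulls T ≤ n * initPulls T := Nat.mul_le_mul_right _ a.isLt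
    refine mem_armRounds.2 ⟨by omega, Fin.ext ?_⟩
    rw [h.explore r (by omega) (by omega) ω]
    exact Nat.div_eq_of_lt_le hr.1 hr.2
  have := Finset.card_le_card hsub
  rwa [Nat.card_Ico, add_mul, one_mul, Nat.add_sub_cancel_left] at this

lemma IsRun.sq_log_le_pulls (h : IsRun ν α T P ℱ A Z) {t : ℕ} (ht : t < T)
    (hI : n * initPulls T ≤ t) (ω : Ω) (a : Fin n) :
    Real.log T ^ 2 ≤ pulls (fun s => A s ω) t a :=
  (Nat.le_ceil _).trans (by exact_mod_cast h.initPulls_le_pulls ht hI ω a)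

lemma IsRun.explored (h : IsRun ν α T P ℱ A Z) (hL : 1 ≤ Real.log T)
    (hlarge : ∀ m a, 8 * α ≤ Real.log T * (pMed ν m a * gam ν m a) ^ 2) {t : ℕ} (ht : t < T)
    (hI : n * initPulls T ≤ t) (ω : Ω) (a : Fin n) :
    Explored ν (4 * α * Real.log T) (fun s => A s ω) t a := by
  have h1 := h.sq_log_le_pulls ht hI ω a
  refine ⟨?_, fun m => ?_⟩
  · have : (0 : ℝ) < pulls (fun s => A s ω) t a := by nlinarith
    exact_mod_cast this
  · calc 2 * (4 * α * Real.log T) = Real.log T * (8 * α) := by ring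
      _ ≤ Real.log T * (Real.log T * (pMed ν m a * gam ν m a) ^ 2) :=
          mul_le_mul_of_nonneg_left (hlarge m a) (by linarith)
      _ = Real.log T ^ 2 * (pMed ν m a * gam ν m a) ^ 2 := by ring
      _ ≤ _ := mul_le_mul_of_nonneg_right h1 (sq_nonneg _)

lemma IsRun.greedy_of_concentrated (hν : IsMAR ν) (h : IsRun ν α T P ℱ A Z) {t : ℕ}
    (ht : t < T) (hI : n * initPulls T ≤ t) {x : ℝ} {ω : Ω}
    (hcon : ∀ a, Concentrated ν c x (fun s => A s ω) (fun s => Z s ω) t a)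
    (hexp : ∀ a, Explored ν x (fun s => A s ω) t a) (b : Fin n) :
    ucb (fun s => A s ω) (fun s => Z s ω) t α T b
      ≤ ucb (fun s => A s ω) (fun s => Z s ω) t α T (A t ω) :=
  h.greedy t ht hI ω (fun m a => (hcon a).card_obsRounds_pos hν (hexp a) m) b

/-- Runs in which some estimate is inaccurate contribute at most `1` to the expected regret. -/
lemma IsRun.integral_regret_le [IsProbabilityMeasure P] (hν : IsMAR ν)
    (hsub : IsSubgaussian ν c) (hc : 0 < c) (h : IsRun ν α T P ℱ A Z) (hα : 1 < α)
    (hT1 : 1 ≤ T) (hT : n * (4 * K + 4) ≤ T) {R : ℝ} (hR0 : 0 ≤ R)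
    (hR : ∀ ω, (∀ t < T, ∀ a, Concentrated ν c (4 * α * Real.log T)
      (fun s => A s ω) (fun s => Z s ω) t a) → regret ν T (fun t => A t ω) ≤ R) :
    ∫ ω, regret ν T (fun t => A t ω) ∂P ≤ R + 1 := by
  have hTpos : (0 : ℝ) < T := by exact_mod_cast hT1
  have hL : 0 ≤ Real.log T := Real.log_natCast_nonneg T
  set x := 4 * α * Real.log T with hx
  have hx0 : 0 ≤ x := by positivity
  set B : Set Ω := ⋃ t ∈ Finset.range T, ⋃ a ∈ (Finset.univ : Finset (Fin n)),
    {ω | ¬ Concentrated ν c x (fun s => A s ω) (fun s => Z s ω) t a} with hB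
  have hexp : Real.exp (-x) ≤ 1 / (T : ℝ) ^ 4 := by
    have h1 : (T : ℝ) ^ 4 = Real.exp (4 * Real.log T) := by
      rw [mul_comm, Real.exp_mul, Real.exp_log hTpos]
      norm_cast
    rw [h1, one_div, ← Real.exp_neg, Real.exp_le_exp]
    nlinarith
  have hPB : P B ≤ ENNReal.ofReal (1 / T) := by
    calc P B ≤ ∑ t ∈ Finset.range T, ∑ a : Fin n,
          P {ω | ¬ Concentrated ν c x (fun s => A s ω) (fun s => Z s ω) t a} :=
          (measure_biUnion_finset_le _ _).trans
            (Finset.sum_le_sum fun t _ => measure_biUnion_finset_le _ _)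
      _ ≤ ∑ t ∈ Finset.range T, ∑ a : Fin n,
          (2 * K + 2) * (T * (2 * ENNReal.ofReal (1 / (T : ℝ) ^ 4))) := by
          refine Finset.sum_le_sum fun t ht => Finset.sum_le_sum fun a _ => ?_
          have ht' := Finset.mem_range.1 ht
          refine (h.measure_not_concentrated_le hν hsub hc ht'.le a hx0).trans ?_
          gcongr
          exact_mod_cast ht'
      _ = ENNReal.ofReal (T * (n * ((2 * K + 2) * (T * (2 * (1 / (T : ℝ) ^ 4)))))) := by
          rw [ENNReal.ofReal_mul (by positivity), ENNReal.ofReal_mul (by positivity),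
            ENNReal.ofReal_mul (by positivity), ENNReal.ofReal_mul (by positivity),
            ENNReal.ofReal_mul (by positivity), ENNReal.ofReal_add (by positivity) (by positivity),
            ENNReal.ofReal_mul (by positivity)]
          simp
      _ ≤ ENNReal.ofReal (1 / T) := by
          refine ENNReal.ofReal_le_ofReal ?_
          have h1 : (n : ℝ) * (4 * K + 4) ≤ T := by exact_mod_cast hT
          calc (T : ℝ) * (n * ((2 * K + 2) * (T * (2 * (1 / (T : ℝ) ^ 4)))))
              = n * (4 * K + 4) / (T : ℝ) ^ 2 := by
                field_simp
                ring
            _ ≤ (T : ℝ) / (T : ℝ) ^ 2 := by gcongr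
            _ = 1 / (T : ℝ) := by field_simp
  set B' := toMeasurable P B with hB'
  have hB'm : MeasurableSet B' := measurableSet_toMeasurable P B
  have hgap0 : ∀ a, 0 ≤ (⨆ b, mu ν b) - mu ν a := fun a => by linarith [mu_le_iSup (ν := ν) a]
  have hpt : ∀ ω, regret ν T (fun t => A t ω) ≤ R + B'.indicator (fun _ => (T : ℝ)) ω := by
    intro ω
    by_cases hω : ω ∈ B'
    · rw [Set.indicator_of_mem hω]
      have : regret ν T (fun t => A t ω) ≤ ∑ t ∈ Finset.range T, (1 : ℝ) :=
        Finset.sum_le_sum fun t _ => hν.iSup_sub_mu_le_one hsub _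
      simp only [Finset.sum_const, Finset.card_range, nsmul_eq_mul, mul_one] at this
      linarith
    · rw [Set.indicator_of_notMem hω, add_zero]
      refine hR ω fun t ht a => ?_
      by_contra hcon
      refine hω (subset_toMeasurable P B ?_)
      simp only [hB, Set.mem_iUnion]
      exact ⟨t, Finset.mem_range.2 ht, a, Finset.mem_univ a, hcon⟩
  have hint : Integrable (B'.indicator fun _ => (T : ℝ)) P :=
    (integrable_const _).indicator hB'm
  calc ∫ ω, regret ν T (fun t => A t ω) ∂P
      ≤ ∫ ω, (R + B'.indicator (fun _ => (T : ℝ)) ω) ∂P :=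
        integral_mono_of_nonneg
          (Eventually.of_forall fun ω => Finset.sum_nonneg fun t _ => hgap0 _)
          ((integrable_const R).add hint) (Eventually.of_forall hpt)
    _ = R + P.real B' * T := by
        rw [integral_add (integrable_const R) hint, integral_indicator hB'm, setIntegral_const]
        simp
    _ ≤ R + 1 / T * T := by
        gcongr
        rw [measureReal_def, measure_toMeasurable]
        exact ENNReal.toReal_le_of_le_ofReal (by positivity) hPB
    _ = R + 1 := by field_simp

end ExpectedRegret

/-! ### Large horizons -/

section Horizon

lemma eventually_initPulls_le (n : ℕ) :
    ∀ᶠ T : ℕ in atTop, (n * initPulls T : ℕ) + 1 ≤ √(T * Real.log T) := by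
  have hlog : Tendsto (fun T : ℕ => Real.log T) atTop atTop :=
    Real.tendsto_log_atTop.comp tendsto_natCast_atTop_atTop
  have h1 := ((Real.isLittleO_pow_log_id_atTop (n := 4)).comp_tendsto
    (tendsto_natCast_atTop_atTop (R := ℝ))).bound
    (show (0 : ℝ) < 1 / (2 * n + 1) ^ 2 by positivity)
  filter_upwards [h1, hlog.eventually_ge_atTop 1] with T hT hL
  simp only [Function.comp_apply, id_eq, Real.norm_eq_abs] at hT
  rw [abs_of_nonneg (by positivity), abs_of_nonneg (by positivity), one_div_mul_eq_div,
    le_div_iff₀ (by positivity)] at hT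
  have hI : (initPulls T : ℝ) ≤ Real.log T ^ 2 + 1 := (Nat.ceil_lt_add_one (by positivity)).le
  have hL2 : 1 ≤ Real.log T ^ 2 := one_le_pow₀ hL
  have h2 : ((n * initPulls T : ℕ) : ℝ) + 1 ≤ Real.log T ^ 2 * (2 * n + 1) := by
    push_cast
    have := mul_le_mul_of_nonneg_left hI (Nat.cast_nonneg (α := ℝ) n)
    have := mul_le_mul_of_nonneg_left hL2 (Nat.cast_nonneg (α := ℝ) n)
    nlinarith
  refine h2.trans (Real.le_sqrt_of_sq_le ?_)
  calc (Real.log T ^ 2 * (2 * n + 1)) ^ 2 = Real.log T ^ 4 * (2 * n + 1) ^ 2 := by ring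
    _ ≤ (T : ℝ) := hT
    _ ≤ T * Real.log T := le_mul_of_one_le_right (Nat.cast_nonneg _) hL

/-- The conditions on the horizon that do not involve the laws of the rewards; `q` stands for the
products `p_{m,a} γ_{m,a}`. -/
lemma eventually_large (n K : ℕ) (α : ℝ) {q : Fin K → Fin n → ℝ} (hq : ∀ m a, 0 < q m a) :
    ∀ᶠ T : ℕ in atTop, 1 ≤ T ∧ 1 ≤ Real.log T ∧ n * (4 * K + 4) ≤ T ∧
      (n * initPulls T : ℕ) + 1 ≤ √(T * Real.log T) ∧
      ∀ m a, 8 * α ≤ Real.log T * q m a ^ 2 := by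
  have hlog : Tendsto (fun T : ℕ => Real.log T) atTop atTop :=
    Real.tendsto_log_atTop.comp tendsto_natCast_atTop_atTop
  have h1 : ∀ᶠ T : ℕ in atTop, ∀ m a, 8 * α ≤ Real.log T * q m a ^ 2 := by
    refine eventually_all.2 fun m => eventually_all.2 fun a => ?_
    have := sq_pos_of_pos (hq m a)
    filter_upwards [hlog.eventually_ge_atTop (8 * α / q m a ^ 2)] with T hT
    rwa [div_le_iff₀ this] at hT
  filter_upwards [eventually_ge_atTop 1, hlog.eventually_ge_atTop 1,
    eventually_ge_atTop (n * (4 * K + 4)), eventually_initPulls_le n, h1] with T h2 h3 h4 h5 h6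
  exact ⟨h2, h3, h4, h5, h6⟩

end Horizon

/-! ### The regret bounds -/

section Bounds

variable {n K : ℕ} {ν : Fin n → Measure (Outcome K)} {c : ℝ≥0} {α : ℝ} {T : ℕ}

lemma IsSubgaussian.mono (hν : IsSubgaussian ν c) {d : ℝ≥0} (hcd : c ≤ d) :
    IsSubgaussian ν d := fun m a =>
  ⟨(hν m a).integrable_exp_mul, fun t => ((hν m a).mgf_le t).trans (Real.exp_le_exp.2 (by
    have : (c : ℝ) ≤ d := hcd
    gcongr))⟩

lemma IsMAR.one_le_n_mul_Smean (hν : IsMAR ν) (hn : 1 ≤ n) : 1 ≤ n * Smean ν :=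
  (hν.one_le_Psum ⟨0, hn⟩).trans (hν.Psum_le hn _)

lemma IsMAR.sqrt_le (hν : IsMAR ν) (hn : 1 ≤ n) (hα : 1 < α) :
    √(T * Real.log T) ≤ √(α * T * Real.log T * (n * Smean ν)) := by
  have hL : 0 ≤ Real.log T := Real.log_natCast_nonneg T
  have h1 : 1 ≤ α * (n * Smean ν) := one_le_mul_of_one_le_of_one_le hα.le (hν.one_le_n_mul_Smean hn)
  refine Real.sqrt_le_sqrt ?_
  calc T * Real.log T ≤ T * Real.log T * (α * (n * Smean ν)) :=
        le_mul_of_one_le_right (by positivity) h1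
    _ = _ := by ring

/-- Variance proxy `1`: the confidence bounds hold, and the widths of the arms pulled add up. -/
lemma regretBound_of_subgaussian_one (hν : IsMAR ν) (hsub : IsSubgaussian ν 1) (hn : 1 ≤ n)
    (hα : 1 < α) (hT1 : 1 ≤ T) (hL : 1 ≤ Real.log T) (hT : n * (4 * K + 4) ≤ T)
    (hI : (n * initPulls T : ℕ) + 1 ≤ √(T * Real.log T))
    (hlarge : ∀ m a, 8 * α ≤ Real.log T * (pMed ν m a * gam ν m a) ^ 2) :
    RegretBound.{u} ν α 100 T := by
  intro Ω mΩ P hP ℱ A Z h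
  have hx : 0 ≤ 4 * α * Real.log T := by positivity
  have hS := hν.one_le_n_mul_Smean hn
  refine (h.integral_regret_le hν hsub one_pos hα hT1 hT
    (R := (n * initPulls T : ℕ) + 3 * (16 * √(4 * α * Real.log T)) * √((∑ a, Psum ν a) * T))
    (by positivity) fun ω hω => ?_).trans ?_
  · have : Nonempty (Fin n) := ⟨⟨0, hn⟩⟩
    refine sum_loss_le (A := fun t => A t ω) (g := fun a => (⨆ b, mu ν b) - mu ν a)
      (fun a => zero_le_one.trans (hν.one_le_Psum a)) (by positivity)
      (fun a => hν.iSup_sub_mu_le_one hsub a) fun t ht hIt => ?_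
    have hexp := h.explored hL hlarge ht hIt ω
    refine ⟨(hexp _).1, sub_le_iff_le_add.2 (ciSup_le fun b => sub_le_iff_le_add.1 ?_)⟩
    exact mu_sub_mu_le_of_greedy hν hx (hω t ht) hexp
      (h.greedy_of_concentrated hν ht hIt (hω t ht) hexp) b
  · have h1 : 3 * (16 * √(4 * α * Real.log T)) * √((∑ a, Psum ν a) * T)
        = 96 * √(α * T * Real.log T * (n * Smean ν)) := by
      have h4 : √(4 : ℝ) = 2 := by
        rw [show (4 : ℝ) = 2 ^ 2 by norm_num, Real.sqrt_sq (by norm_num)]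
      rw [← n_mul_Smean hn, mul_assoc 4, Real.sqrt_mul (by norm_num), h4,
        show α * T * Real.log T * (n * Smean ν) = α * Real.log T * (n * Smean ν * T) by ring,
        Real.sqrt_mul (x := α * Real.log T) (by positivity)]
      ring
    have h2 := hν.sqrt_le (T := T) hn hα
    have h3 : 0 ≤ √(T * Real.log T) := Real.sqrt_nonneg _
    linarith

/-- Any variance proxy: when the horizon is so large that the initial pulls separate the means of
the arms, no suboptimal arm is pulled after them. -/
lemma regretBound_of_gaps (hν : IsMAR ν) (hsub : IsSubgaussian ν c) (hc : 0 < c) (hn : 1 ≤ n)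
    (hα : 1 < α) (hT1 : 1 ≤ T) (hL : 1 ≤ Real.log T) (hT : n * (4 * K + 4) ≤ T)
    (hI : (n * initPulls T : ℕ) + 1 ≤ √(T * Real.log T))
    (hlarge : ∀ m a, 8 * α ≤ Real.log T * (pMed ν m a * gam ν m a) ^ 2)
    (hgap : ∀ a, 0 < (⨆ b, mu ν b) - mu ν a →
      (2 * (√(2 * c) + √(1 / 2)) + √8) * √(32 * α * (n * Smean ν) / Real.log T)
        < (⨆ b, mu ν b) - mu ν a) :
    RegretBound.{u} ν α 100 T := by
  intro Ω mΩ P hP ℱ A Z h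
  have hx : 0 ≤ 4 * α * Real.log T := by positivity
  refine (h.integral_regret_le hν hsub hc hα hT1 hT (R := (n * initPulls T : ℕ))
    (by positivity) fun ω hω => ?_).trans ?_
  · have : Nonempty (Fin n) := ⟨⟨0, hn⟩⟩
    have key := sum_loss_le (A := fun t => A t ω) (g := fun a => (⨆ b, mu ν b) - mu ν a)
      (w := fun _ => 0) (κ := 0) (T := T) (I := n * initPulls T)
      (fun a => le_rfl) le_rfl (fun a => hν.iSup_sub_mu_le_one hsub a) fun t ht hIt => ?_
    · simp only [mul_zero, zero_mul, add_zero] at key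
      exact key
    have hexp := h.explored hL hlarge ht hIt ω
    refine ⟨(hexp _).1, ?_⟩
    rw [zero_mul]
    by_contra! hpos
    refine absurd (hgap _ hpos) (not_lt.2 ?_)
    refine sub_le_iff_le_add.2 (ciSup_le fun b => sub_le_iff_le_add.1 ?_)
    refine mu_sub_mu_le_of_widthSq_le hν hx (hω t ht) hexp (fun a => ?_)
      (h.greedy_of_concentrated hν ht hIt (hω t ht) hexp) b
    have hL0 : 0 < Real.log T := by linarith
    have hP0 := zero_le_one.trans (hν.one_le_Psum a)
    calc 4 * α * Real.log T * widthSq (fun s => A s ω) (fun s => Z s ω) t a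
        ≤ 4 * α * Real.log T * (8 * Psum ν a / pulls (fun s => A s ω) t a) :=
          mul_le_mul_of_nonneg_left ((hω t ht a).widthSq_le hν (hexp a)) hx
      _ ≤ 4 * α * Real.log T * (8 * ((n : ℝ) * Smean ν) / Real.log T ^ 2) := by
          gcongr
          · exact mul_nonneg (by norm_num) (hP0.trans (hν.Psum_le hn a))
          · exact hν.Psum_le hn a
          · exact h.sq_log_le_pulls ht hIt ω a
      _ = 32 * α * (n * Smean ν) / Real.log T := by
          field_simp
          ring
  · have h2 := hν.sqrt_le (T := T) hn hα
    have h3 : 0 ≤ √(T * Real.log T) := Real.sqrt_nonneg _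
    linarith

lemma eventually_lt_gap (α D S g : ℝ) (hg : 0 < g) :
    ∀ᶠ T : ℕ in atTop, D * √(32 * α * S / Real.log T) < g := by
  have hlog : Tendsto (fun T : ℕ => Real.log T) atTop atTop :=
    Real.tendsto_log_atTop.comp tendsto_natCast_atTop_atTop
  have h1 : Tendsto (fun T : ℕ => D * √(32 * α * S / Real.log T)) atTop (nhds (D * √0)) :=
    (hlog.const_div_atTop _).sqrt.const_mul D
  rw [Real.sqrt_zero, mul_zero] at h1
  exact h1.eventually_lt_const hg

end Bounds

end MissingBandit

theorem mainTheorem4 :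
    ∃ C : ℝ, 0 < C ∧ ∀ (n K : ℕ) (α : ℝ), 1 ≤ n → 1 < α →
      -- rewards of variance proxy `1`: how large `T` has to be depends only on `n`, `K`, `α` and
      -- the numbers `p_{m,a}`, `γ_{m,a}`, not on the reward distributions or the gaps
      (∀ p γ : Fin K → Fin n → ℝ, ∃ T₀ : ℕ,
        ∀ ν : Fin n → MeasureTheory.Measure (MissingBandit.Outcome K),
          MissingBandit.IsMAR ν →
          (∀ m a, MissingBandit.pMed ν m a = p m a) →
          (∀ m a, MissingBandit.gam ν m a = γ m a) →
          MissingBandit.IsSubgaussian ν 1 →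
          ∀ T : ℕ, T₀ ≤ T → MissingBandit.RegretBound.{u} ν α C T) ∧
      -- rewards of arbitrary variance proxy: `T` sufficiently large for the given instance
      (∀ ν : Fin n → MeasureTheory.Measure (MissingBandit.Outcome K),
          MissingBandit.IsMAR ν →
          (∃ c : NNReal, MissingBandit.IsSubgaussian ν c) →
          ∃ T₀ : ℕ, ∀ T : ℕ, T₀ ≤ T → MissingBandit.RegretBound.{u} ν α C T) := by
  -- The confidence widths contribute `96`; the initial rounds and the inaccurate runs are of
  -- lower order.
  open MissingBandit in
  refine ⟨100, by norm_num, fun n K α hn hα => ⟨fun p γ => ?_, fun ν hν ⟨c, hc⟩ => ?_⟩⟩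
  · by_cases hpos : ∀ m a, 0 < p m a * γ m a
    · obtain ⟨T₀, hT₀⟩ := eventually_atTop.1 (eventually_large n K α hpos)
      refine ⟨T₀, fun ν hν hp hγ hsub T hT => ?_⟩
      obtain ⟨h1, h2, h3, h4, h5⟩ := hT₀ T hT
      exact regretBound_of_subgaussian_one hν hsub hn hα h1 h2 h3 h4 fun m a => by
        rw [hp, hγ]
        exact h5 m a
    · refine ⟨0, fun ν hν hp hγ => absurd (fun m a => ?_) hpos⟩
      rw [← hp, ← hγ]
      exact mul_pos (hν.pMed_pos m a) (hν.gam_pos m a)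
  · have hgaps : ∀ᶠ T : ℕ in atTop, ∀ a, 0 < (⨆ b, mu ν b) - mu ν a →
        (2 * (√(2 * (c + 1 : ℝ≥0)) + √(1 / 2)) + √8) * √(32 * α * (n * Smean ν) / Real.log T)
          < (⨆ b, mu ν b) - mu ν a := by
      refine eventually_all.2 fun a => ?_
      by_cases ha : 0 < (⨆ b, mu ν b) - mu ν a
      · filter_upwards [eventually_lt_gap α _ _ _ ha] with T hT _
        exact hT
      · exact Eventually.of_forall fun T h => absurd h ha
    obtain ⟨T₀, hT₀⟩ := eventually_atTop.1 ((eventually_large n K α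
      (q := fun m a => pMed ν m a * gam ν m a)
      fun m a => mul_pos (hν.pMed_pos m a) (hν.gam_pos m a)).and hgaps)
    refine ⟨T₀, fun T hT => ?_⟩
    obtain ⟨⟨h1, h2, h3, h4, h5⟩, h6⟩ := hT₀ T hT
    -- The variance proxy is enlarged so that it is positive.
    exact regretBound_of_gaps hν (IsSubgaussian.mono hc (le_add_of_nonneg_right zero_le_one))
      (by positivity) hn hα h1 h2 h3 h4 h5 h6
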